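/- Conventions. All manifolds, maps and vector fields are smooth; $R(X,Y)Z=[\nabla_X,\nabla_Y]Z-\nabla_{[X,Y]}Z$ and $\Delta=\mathrm{div}\,\mathrm{grad}$. For a map $\varphi:(M,g)\to(N,h)$ of Riemannian manifolds let $\tau(\varphi)=\mathrm{Trace}_g\nabla d\varphi$ be its tension field and $$J^{\varphi}(V)=-\{\mathrm{Trace}_g(\nabla^{\varphi}\nabla^{\varphi}-\nabla^{\varphi}_{\nabla^M})V-\mathrm{Trace}_gR^N(d\varphi,V)d\varphi\}$$ its Jacobi operator. For a function $f:M\to(0,+\infty)$ put $\tau_2(\varphi)=-J^{\varphi}(\tau(\varphi))$ and $\tau_{2,f}(\varphi)=-J^{\varphi}(f\,\tau(\varphi))$. The map $\varphi$ is biharmonic if $\tau_2(\varphi)\equiv0$, $f$-biharmonic if $\tau_{2,f}(\varphi)\equiv0$, and proper $f$-biharmonic if it is $f$-biharmonic but not biharmonic. Theorem. Let $c\in\mathbb R$, let $(M^3,g)$ be a Riemannian 3-manifold of constant sectional curvature $c$ (not necessarily complete), let $(N^2,h)$ be a Riemannian surface of constant Gauss curvature $c$, and let $\pi:M\to N$ be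 a Riemannian submersion (not necessarily surjective). Let $\{e_1,e_2,e_3\}$ be an orthonormal frame on $M$ adapted to $\pi$: $e_3$ is vertical, and $e_1,e_2$ are basic, i.e. horizontal and $\pi$-related to vector fields $\varepsilon_1,\varepsilon_2$ on the open set $\pi(M)$. Let $f_1,f_2,\kappa_1,\kappa_2,\sigma$ be its integrability data, defined by $$[e_1,e_3]=\kappa_1e_3,\qquad [e_2,e_3]=\kappa_2e_3,\qquad [e_1,e_2]=f_1e_1+f_2e_2-2\sigma e_3,$$ and suppose that $\kappa_2\equiv0$. Let $f:M\to(0,+\infty)$ be a smooth function. If $c\neq0$, then $\kappa_1$ has no zeros. Moreover, $\pi$ is proper $f$-biharmonic if and only if $$-\Delta^M(f\kappa_1)+f\kappa_1\Bigl(-c+\frac{c^2}{\kappa_1^2}\Bigr)=0 \text{ on } M,\qquad c\,e_2(f)=0 \text{ on } M,\qquad -\Delta^M\kappa_1+\kappa_1\Bigl(-c+\frac{c^2}{\kappa_1^2}\Bigr)\not\equiv0 \text{ on } M,$$ where for $c=0$ the term $c^2/\kappa_1^2$ is read as $0$, also at zeros of $\kappa_1$. -/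

import Mathlib

open Bundle Module
open scoped Manifold ContDiff

noncomputable section

/-! ### Riemannian geometry of one manifold

Throughout, `M` is a real manifold modelled on a finite-dimensional space, and its Riemannian metric
is given by the type class `RiemannianBundle` on the tangent bundle. Vector fields are functions
`X : (p : M) → TangentSpace I p`. A tangent vector `v` at `p` is extended, where an
extension is needed, to the field `FiberBundle.extend E v`, which is smooth near `p`; the objects
below are tensorial in `v`, so that the choice of the extension is immaterial. -/

section OneManifold

variable {E : Type*} [NormedAddCommGroup E] [NormedSpace ℝ E] [FiniteDimensional ℝ E]
  {H : Type*} [TopologicalSpace H] (I : ModelWithCorners ℝ E H)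
  {M : Type*} [TopologicalSpace M] [ChartedSpace H M] [IsManifold I ∞ M]

/-- The derivative `X(h)` of a function `h` along a vector field `X`. -/
def fieldDeriv (X : (p : M) → TangentSpace I p) (h : M → ℝ) (p : M) : ℝ :=
  mvfderiv I h p (X p)

variable [RiemannianBundle (fun p : M => TangentSpace I p)]

/-- The right-hand side of the Koszul formula, that is, `⟨∇_X Y, Z⟩`. -/
def koszul (X Y Z : (p : M) → TangentSpace I p) (p : M) : ℝ :=
  (fieldDeriv I X (fun q => inner ℝ (Y q) (Z q)) p
    + fieldDeriv I Y (fun q => inner ℝ (X q) (Z q)) p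
    - fieldDeriv I Z (fun q => inner ℝ (X q) (Y q)) p
    + inner ℝ (VectorField.mlieBracket I X Y p) (Z p)
    - inner ℝ (VectorField.mlieBracket I X Z p) (Y p)
    - inner ℝ (VectorField.mlieBracket I Y Z p) (X p)) / 2

/-- An orthonormal basis of the tangent space at `p`. -/
def tangentONB (p : M) :
    OrthonormalBasis (Fin (finrank ℝ (TangentSpace I p))) ℝ (TangentSpace I p) :=
  haveI : FiniteDimensional ℝ (TangentSpace I p) := inferInstanceAs (FiniteDimensional ℝ E)
  stdOrthonormalBasis ℝ (TangentSpace I p)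

/-- The Levi-Civita connection `∇_X Y`: the vector whose inner product with each tangent vector
is given by the Koszul formula. -/
def leviCivita (X Y : (p : M) → TangentSpace I p) (p : M) : TangentSpace I p :=
  ∑ i, koszul I X Y (FiberBundle.extend E (tangentONB I p i)) p • tangentONB I p i

/-- `∇_X ∇_Y Z - ∇_Y ∇_X Z - ∇_[X,Y] Z`. -/
def curvatureField (X Y Z : (p : M) → TangentSpace I p) (p : M) : TangentSpace I p :=
  leviCivita I X (leviCivita I Y Z) p - leviCivita I Y (leviCivita I X Z) p
    - leviCivita I (VectorField.mlieBracket I X Y) Z p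

/-- The curvature tensor `R(u,v)w` at a point, with the convention
`R(X,Y)Z = [∇_X, ∇_Y] Z - ∇_[X,Y] Z`. -/
def curvature {p : M} (u v w : TangentSpace I p) : TangentSpace I p :=
  curvatureField I (FiberBundle.extend E u) (FiberBundle.extend E v) (FiberBundle.extend E w) p

variable (M) in
/-- All sectional curvatures equal `c` (for a surface: the Gauss curvature is `c`). -/
def HasConstantCurvature (c : ℝ) : Prop :=
  ∀ (p : M) (u v : TangentSpace I p),
    inner ℝ (curvature I u v v) u
      = c * (inner ℝ u u * inner ℝ v v - inner ℝ u v ^ 2)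

/-- The Laplace-Beltrami operator: the trace of the Hessian `U(U h) - (∇_U U) h`. -/
def laplacian (h : M → ℝ) (p : M) : ℝ :=
  ∑ i, (fieldDeriv I (FiberBundle.extend E (tangentONB I p i))
          (fieldDeriv I (FiberBundle.extend E (tangentONB I p i)) h) p
        - fieldDeriv I (leviCivita I (FiberBundle.extend E (tangentONB I p i))
          (FiberBundle.extend E (tangentONB I p i))) h p)

end OneManifold

/-! ### Maps between Riemannian manifolds

Vector fields along `φ : M → N` are functions `V : (p : M) → TangentSpace J (φ p)`. -/

section Maps

variable {E : Type*} [NormedAddCommGroup E] [NormedSpace ℝ E] [FiniteDimensional ℝ E]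
  {H : Type*} [TopologicalSpace H] (I : ModelWithCorners ℝ E H)
  {M : Type*} [TopologicalSpace M] [ChartedSpace H M] [IsManifold I ∞ M]
  [RiemannianBundle (fun p : M => TangentSpace I p)]
  {E' : Type*} [NormedAddCommGroup E'] [NormedSpace ℝ E'] [FiniteDimensional ℝ E']
  {H' : Type*} [TopologicalSpace H'] (J : ModelWithCorners ℝ E' H')
  {N : Type*} [TopologicalSpace N] [ChartedSpace H' N] [IsManifold J ∞ N]
  [RiemannianBundle (fun y : N => TangentSpace J y)]

/-- The vector field `dφ(X)` along `φ`. -/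
def pushAlong (φ : M → N) (X : (p : M) → TangentSpace I p) (p : M) : TangentSpace J (φ p) :=
  mfderiv I J φ p (X p)

/-- The pull-back connection `∇^φ_X V` of the Levi-Civita connection of `N`. Writing
`V = ∑ Vᵃ (Eₐ ∘ φ)` with the local frame `Eₐ` of `N` near `φ p` that belongs to the
trivialization of the tangent bundle at `φ p`, it is
`∑ X(Vᵃ) (Eₐ ∘ φ) + ∑ Vᵃ (∇_{dφ(X)} Eₐ)`. -/
def pullbackConn (φ : M → N) (X : (p : M) → TangentSpace I p)
    (V : (p : M) → TangentSpace J (φ p)) (p : M) : TangentSpace J (φ p) :=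
  ∑ a,
    (fieldDeriv I X (fun q => (trivializationAt E' (TangentSpace J : N → Type _) (φ p)).localFrameCoeff
        J (finBasis ℝ E') a (φ q) (V q)) p
      • (trivializationAt E' (TangentSpace J : N → Type _) (φ p)).localFrame
        (finBasis ℝ E') a (φ p)
    + (trivializationAt E' (TangentSpace J : N → Type _) (φ p)).localFrameCoeff
        J (finBasis ℝ E') a (φ p) (V p)
      • leviCivita J (FiberBundle.extend E' (pushAlong I J φ X p))
        ((trivializationAt E' (TangentSpace J : N → Type _) (φ p)).localFrame
          (finBasis ℝ E') a) (φ p))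

/-- The tension field `τ(φ) = Trace ∇dφ`. -/
def tension (φ : M → N) (p : M) : TangentSpace J (φ p) :=
  ∑ i, (pullbackConn I J φ (FiberBundle.extend E (tangentONB I p i))
          (pushAlong I J φ (FiberBundle.extend E (tangentONB I p i))) p
        - pushAlong I J φ (leviCivita I (FiberBundle.extend E (tangentONB I p i))
          (FiberBundle.extend E (tangentONB I p i))) p)

/-- The rough Laplacian `Trace (∇^φ ∇^φ - ∇^φ_{∇^M}) V`. -/
def roughLaplacian (φ : M → N) (V : (p : M) → TangentSpace J (φ p)) (p : M) :
    TangentSpace J (φ p) :=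
  ∑ i, (pullbackConn I J φ (FiberBundle.extend E (tangentONB I p i))
          (pullbackConn I J φ (FiberBundle.extend E (tangentONB I p i)) V) p
        - pullbackConn I J φ (leviCivita I (FiberBundle.extend E (tangentONB I p i))
          (FiberBundle.extend E (tangentONB I p i))) V p)

/-- The Jacobi operator
`J^φ(V) = -(Trace (∇^φ ∇^φ - ∇^φ_{∇^M}) V - Trace R^N(dφ, V) dφ)`. -/
def jacobiOperator (φ : M → N) (V : (p : M) → TangentSpace J (φ p)) (p : M) :
    TangentSpace J (φ p) :=
  -(roughLaplacian I J φ V p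
    - ∑ i, curvature J (mfderiv I J φ p (tangentONB I p i)) (V p)
        (mfderiv I J φ p (tangentONB I p i)))

/-- The bitension field `τ₂(φ) = -J^φ(τ(φ))`. -/
def bitension (φ : M → N) (p : M) : TangentSpace J (φ p) :=
  -jacobiOperator I J φ (tension I J φ) p

/-- The `f`-bitension field `τ_{2,f}(φ) = -J^φ(f τ(φ))`. -/
def fBitension (f : M → ℝ) (φ : M → N) (p : M) : TangentSpace J (φ p) :=
  -jacobiOperator I J φ (fun q => f q • tension I J φ q) p

/-- The map `φ` is biharmonic. -/
def IsBiharmonic (φ : M → N) : Prop := ∀ p, bitension I J φ p = 0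

/-- The map `φ` is `f`-biharmonic. -/
def IsFBiharmonic (f : M → ℝ) (φ : M → N) : Prop := ∀ p, fBitension I J f φ p = 0

/-- The map `φ` is `f`-biharmonic but not biharmonic. -/
def IsProperFBiharmonic (f : M → ℝ) (φ : M → N) : Prop :=
  IsFBiharmonic I J f φ ∧ ¬ IsBiharmonic I J φ

/-- A Riemannian submersion: a smooth submersion whose differential preserves inner products of
horizontal vectors, that is, of vectors orthogonal to the kernel of the differential. -/
structure IsRiemannianSubmersion (φ : M → N) : Prop where
  contMDiff : ContMDiff I J ∞ φ
  surjective (p : M) : Function.Surjective (mfderiv I J φ p)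
  isometric (p : M) (u v : TangentSpace I p)
    (hu : ∀ w : TangentSpace I p, mfderiv I J φ p w = 0 → inner ℝ u w = 0)
    (hv : ∀ w : TangentSpace I p, mfderiv I J φ p w = 0 → inner ℝ v w = 0) :
    inner ℝ (mfderiv I J φ p u) (mfderiv I J φ p v) = inner ℝ u v

/-- A smooth orthonormal frame `e₁, e₂, e₃` of `M` is adapted to `φ` if `e₃` is vertical and
`e₁, e₂` are basic: they are horizontal and `φ`-related to smooth vector fields `ε₁, ε₂` on the
(open) image of `φ`.
(Horizontality follows from orthonormality, the kernel of `dφ` being spanned by `e₃` when `φ` is a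
submersion from a 3-manifold to a surface.) -/
structure IsAdaptedFrame (φ : M → N) (e₁ e₂ e₃ : (p : M) → TangentSpace I p) : Prop where
  contMDiff₁ : ContMDiff I I.tangent ∞ (fun p => (⟨p, e₁ p⟩ : TangentBundle I M))
  contMDiff₂ : ContMDiff I I.tangent ∞ (fun p => (⟨p, e₂ p⟩ : TangentBundle I M))
  contMDiff₃ : ContMDiff I I.tangent ∞ (fun p => (⟨p, e₃ p⟩ : TangentBundle I M))
  orthonormal (p : M) : Orthonormal ℝ ![e₁ p, e₂ p, e₃ p]
  vertical (p : M) : mfderiv I J φ p (e₃ p) = 0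
  basic₁ : ∃ ε₁ : (y : N) → TangentSpace J y,
    ContMDiffOn J J.tangent ∞ (fun y => (⟨y, ε₁ y⟩ : TangentBundle J N)) (Set.range φ) ∧
      ∀ p, mfderiv I J φ p (e₁ p) = ε₁ (φ p)
  basic₂ : ∃ ε₂ : (y : N) → TangentSpace J y,
    ContMDiffOn J J.tangent ∞ (fun y => (⟨y, ε₂ y⟩ : TangentBundle J N)) (Set.range φ) ∧
      ∀ p, mfderiv I J φ p (e₂ p) = ε₂ (φ p)

variable (M) in
/-- The five functions `f₁, f₂, κ₁, κ₂, σ` on `M`. -/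
structure IntegrabilityData where
  f₁ : M → ℝ
  f₂ : M → ℝ
  κ₁ : M → ℝ
  κ₂ : M → ℝ
  σ : M → ℝ

/-- The integrability data of an orthonormal frame, read off from `[e₁,e₃] = κ₁ e₃`,
`[e₂,e₃] = κ₂ e₃`, `[e₁,e₂] = f₁ e₁ + f₂ e₂ - 2σ e₃`. -/
def integrabilityData (e₁ e₂ e₃ : (p : M) → TangentSpace I p) : IntegrabilityData M where
  f₁ p := inner ℝ (VectorField.mlieBracket I e₁ e₂ p) (e₁ p)
  f₂ p := inner ℝ (VectorField.mlieBracket I e₁ e₂ p) (e₂ p)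
  κ₁ p := inner ℝ (VectorField.mlieBracket I e₁ e₃ p) (e₃ p)
  κ₂ p := inner ℝ (VectorField.mlieBracket I e₂ e₃ p) (e₃ p)
  σ p := -inner ℝ (VectorField.mlieBracket I e₁ e₂ p) (e₃ p) / 2

end Maps

end

section Fields

open Filter Topology VectorField

set_option linter.unusedSectionVars false

variable {E : Type*} [NormedAddCommGroup E] [NormedSpace ℝ E]
  {H : Type*} [TopologicalSpace H] {I : ModelWithCorners ℝ E H}
  {M : Type*} [TopologicalSpace M] [ChartedSpace H M] [IsManifold I ∞ M]

/-- A vector field that is smooth at all points near `p`. -/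
def IsSmoothFieldNear (I : ModelWithCorners ℝ E H) {M : Type*} [TopologicalSpace M]
    [ChartedSpace H M] [IsManifold I ∞ M] (X : (p : M) → TangentSpace I p) (p : M) : Prop :=
  ∀ᶠ q in 𝓝 p, ContMDiffAt I I.tangent ∞ (fun x => (⟨x, X x⟩ : TangentBundle I M)) q

/-- A function that is smooth at all points near `p`. -/
def IsSmoothFunNear (I : ModelWithCorners ℝ E H) {M : Type*} [TopologicalSpace M]
    [ChartedSpace H M] (h : M → ℝ) (p : M) : Prop :=
  ∀ᶠ q in 𝓝 p, ContMDiffAt I 𝓘(ℝ, ℝ) ∞ h q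

variable {X Y Z : (p : M) → TangentSpace I p} {g h : M → ℝ} {p : M}

namespace IsSmoothFieldNear

lemma contMDiffAt (hX : IsSmoothFieldNear I X p) :
    ContMDiffAt I I.tangent ∞ (fun x => (⟨x, X x⟩ : TangentBundle I M)) p :=
  hX.self_of_nhds

lemma mdifferentiableAt (hX : IsSmoothFieldNear I X p) : MDiffAt (T% X) p :=
  hX.contMDiffAt.mdifferentiableAt (by simp)

lemma eventually (hX : IsSmoothFieldNear I X p) : ∀ᶠ q in 𝓝 p, IsSmoothFieldNear I X q :=
  hX.eventually_nhds

lemma of_contMDiff (hX : ContMDiff I I.tangent ∞ (fun x => (⟨x, X x⟩ : TangentBundle I M))) :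
    IsSmoothFieldNear I X p :=
  .of_forall fun q => hX q

lemma add (hX : IsSmoothFieldNear I X p) (hY : IsSmoothFieldNear I Y p) :
    IsSmoothFieldNear I (X + Y) p := by
  filter_upwards [hX, hY] with q h₁ h₂ using h₁.add_section h₂

lemma sub (hX : IsSmoothFieldNear I X p) (hY : IsSmoothFieldNear I Y p) :
    IsSmoothFieldNear I (X - Y) p := by
  filter_upwards [hX, hY] with q h₁ h₂ using h₁.sub_section h₂

lemma smul (hh : IsSmoothFunNear I h p) (hX : IsSmoothFieldNear I X p) :
    IsSmoothFieldNear I (h • X) p := by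
  filter_upwards [hh, hX] with q h₁ h₂ using h₁.smul_section h₂

lemma sum {ι : Type*} [Fintype ι] {X : ι → (p : M) → TangentSpace I p}
    (hX : ∀ i, IsSmoothFieldNear I (X i) p) :
    IsSmoothFieldNear I (fun q => ∑ i, X i q) p := by
  filter_upwards [eventually_all.2 hX] with q h₁
  exact ContMDiffAt.sum_section fun i _ => h₁ i

lemma congr (hX : IsSmoothFieldNear I X p) (h : Y =ᶠ[𝓝 p] X) : IsSmoothFieldNear I Y p := by
  filter_upwards [hX, h.eventuallyEq_nhds] with q h₁ h₂
  exact h₁.congr_of_eventuallyEq (h₂.mono fun x hx => by simp [hx])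

lemma extend [FiniteDimensional ℝ E] (v : TangentSpace I p) :
    IsSmoothFieldNear I (FiberBundle.extend E v) p := by
  obtain ⟨u, hu, h⟩ := FiberBundle.exists_contMDiffOn_extend I E (k := ∞) v
  filter_upwards [eventually_mem_nhds_iff.2 hu] with q hq using h.contMDiffAt hq

lemma mlieBracket [CompleteSpace E] (hX : IsSmoothFieldNear I X p) (hY : IsSmoothFieldNear I Y p) :
    IsSmoothFieldNear I (mlieBracket I X Y) p := by
  filter_upwards [hX, hY] with q h₁ h₂
  have : IsManifold I (minSmoothness ℝ 2) M := by simpa using (inferInstance : IsManifold I 2 M)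
  have : IsManifold I (minSmoothness ℝ 3) M := by simpa using (inferInstance : IsManifold I 3 M)
  have : IsManifold I (((⊤ : ℕ∞) : ℕ∞ω) + 1) M := by simpa using ‹IsManifold I ∞ M›
  exact ContMDiffAt.mlieBracket_vectorField (n := ⊤) (m := ⊤) h₁ h₂ (by simp)

end IsSmoothFieldNear

namespace IsSmoothFunNear

lemma mdifferentiableAt (hh : IsSmoothFunNear I h p) : MDiffAt h p :=
  hh.self_of_nhds.mdifferentiableAt (by simp)

lemma eventually (hh : IsSmoothFunNear I h p) : ∀ᶠ q in 𝓝 p, IsSmoothFunNear I h q :=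
  hh.eventually_nhds

lemma of_contMDiff (hh : ContMDiff I 𝓘(ℝ, ℝ) ∞ h) : IsSmoothFunNear I h p :=
  .of_forall fun q => hh q

lemma const (c : ℝ) : IsSmoothFunNear I (fun _ : M => c) p :=
  .of_contMDiff contMDiff_const

lemma add (hg : IsSmoothFunNear I g p) (hh : IsSmoothFunNear I h p) :
    IsSmoothFunNear I (fun q => g q + h q) p := by
  filter_upwards [hg, hh] with q h₁ h₂ using h₁.add h₂

lemma mul (hg : IsSmoothFunNear I g p) (hh : IsSmoothFunNear I h p) :
    IsSmoothFunNear I (fun q => g q * h q) p := by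
  filter_upwards [hg, hh] with q h₁ h₂ using h₁.mul h₂

lemma neg (hg : IsSmoothFunNear I g p) : IsSmoothFunNear I (fun q => -g q) p := by
  filter_upwards [hg] with q h₁ using h₁.neg

lemma congr (hg : IsSmoothFunNear I g p) (e : h =ᶠ[𝓝 p] g) : IsSmoothFunNear I h p := by
  filter_upwards [hg, e.eventuallyEq_nhds] with q h₁ h₂ using h₁.congr_of_eventuallyEq h₂

end IsSmoothFunNear

section FieldDeriv

open Filter Topology VectorField

lemma fieldDeriv_congr (e : g =ᶠ[𝓝 p] h) : fieldDeriv I X g p = fieldDeriv I X h p := by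
  simp only [fieldDeriv, mvfderiv, e.mfderiv_eq]
  rfl

lemma fieldDeriv_congr_field (e : X p = Y p) : fieldDeriv I X h p = fieldDeriv I Y h p := by
  simp only [fieldDeriv, e]

lemma fieldDeriv_const (c : ℝ) : fieldDeriv I X (fun _ => c) p = 0 := by
  simp [fieldDeriv, mvfderiv_const]

lemma fieldDeriv_add (hg : MDiffAt g p) (hh : MDiffAt h p) :
    fieldDeriv I X (fun q => g q + h q) p = fieldDeriv I X g p + fieldDeriv I X h p := by
  simp [fieldDeriv, mvfderiv_fun_add hg hh]

lemma fieldDeriv_neg : fieldDeriv I X (fun q => -h q) p = -fieldDeriv I X h p := by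
  simp [fieldDeriv, mvfderiv_fun_neg]

lemma fieldDeriv_mul (hg : MDiffAt g p) (hh : MDiffAt h p) :
    fieldDeriv I X (fun q => g q * h q) p
      = fieldDeriv I X g p * h p + g p * fieldDeriv I X h p := by
  simp [fieldDeriv, mvfderiv_fun_mul hg hh]
  ring

lemma fieldDeriv_sum {ι : Type*} [Fintype ι] {h : ι → M → ℝ} (hh : ∀ i, MDiffAt (h i) p) :
    fieldDeriv I X (fun q => ∑ i, h i q) p = ∑ i, fieldDeriv I X (h i) p := by
  classical
  suffices ∀ s : Finset ι, MDiffAt (fun q => ∑ i ∈ s, h i q) p ∧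
      fieldDeriv I X (fun q => ∑ i ∈ s, h i q) p = ∑ i ∈ s, fieldDeriv I X (h i) p from
    (this Finset.univ).2
  intro s
  induction s using Finset.induction_on with
  | empty => simpa [fieldDeriv_const] using mdifferentiableAt_const
  | insert a s ha ih =>
    simp only [Finset.sum_insert ha]
    exact ⟨(hh a).add ih.1, by rw [fieldDeriv_add (hh a) ih.1, ih.2]⟩

lemma fieldDeriv_add_field : fieldDeriv I (X + Y) h p = fieldDeriv I X h p + fieldDeriv I Y h p := by
  simp [fieldDeriv]

lemma fieldDeriv_smul_field : fieldDeriv I (g • X) h p = g p * fieldDeriv I X h p := by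
  simp [fieldDeriv]

lemma mlieBracket_smul_right' [CompleteSpace E] (hh : MDiffAt h p) (hY : MDiffAt (T% Y) p) :
    mlieBracket I X (h • Y) p = fieldDeriv I X h p • Y p + h p • mlieBracket I X Y p :=
  mlieBracket_smul_right hh hY

lemma mlieBracket_smul_left' [CompleteSpace E] (hh : MDiffAt h p) (hX : MDiffAt (T% X) p) :
    mlieBracket I (h • X) Y p = -(fieldDeriv I Y h p • X p) + h p • mlieBracket I X Y p := by
  rw [mlieBracket_smul_left hh hX, fieldDeriv, neg_smul]

end FieldDeriv

section Smoothness

open Filter Topology VectorField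

variable [FiniteDimensional ℝ E] [CompleteSpace E] [RiemannianBundle (fun p : M => TangentSpace I p)]
  [IsContMDiffRiemannianBundle I ∞ E (fun p : M => TangentSpace I p)]

lemma IsSmoothFieldNear.inner (hX : IsSmoothFieldNear I X p) (hY : IsSmoothFieldNear I Y p) :
    IsSmoothFunNear I (fun q => inner ℝ (X q) (Y q)) p := by
  filter_upwards [hX, hY] with q h₁ h₂ using
    ContMDiffAt.inner_bundle (E := fun p : M => TangentSpace I p) h₁ h₂

lemma IsSmoothFieldNear.fieldDeriv (hX : IsSmoothFieldNear I X p) (hh : IsSmoothFunNear I h p) :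
    IsSmoothFunNear I (fieldDeriv I X h) p := by
  by_cases hs : ∀ v : TangentSpace I p, v = 0
  · have : Subsingleton E := ⟨fun a b => (hs a).trans (hs b).symm⟩
    refine (IsSmoothFunNear.const (I := I) (p := p) 0).congr (.of_forall fun q => ?_)
    have : X q = 0 := Subsingleton.elim (α := E) _ _
    simp [_root_.fieldDeriv, this]
  push Not at hs
  obtain ⟨v, hv⟩ := hs
  set Z := FiberBundle.extend E v with hZ
  have sZ : IsSmoothFieldNear I Z p := .extend v
  have sZZ := sZ.inner sZ
  have pos : ∀ᶠ q in 𝓝 p, (0 : ℝ) < Inner.inner ℝ (Z q) (Z q) := by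
    refine sZZ.self_of_nhds.continuousAt.eventually_const_lt ?_
    simpa [hZ] using real_inner_self_pos.2 hv
  have key := ((hX.mlieBracket (sZ.smul hh)).sub ((hX.mlieBracket sZ).smul hh)).inner sZ
  filter_upwards [key, sZZ, hh.eventually, sZ.eventually, pos, pos.eventually_nhds,
    hh.eventually.eventually_nhds, sZ.eventually.eventually_nhds] with q k₁ k₂ k₃ k₄ k₅ k₆ k₇ k₈
  refine (k₁.div₀ k₂ k₅.ne').congr_of_eventuallyEq ?_
  filter_upwards [k₆, k₇, k₈] with x h₁ h₂ h₃
  simp only [Pi.sub_apply, Pi.smul_apply', Pi.div_apply]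
  rw [mlieBracket_smul_right' h₂.mdifferentiableAt h₃.mdifferentiableAt, add_sub_cancel_right,
    real_inner_smul_left]
  field_simp

lemma fieldDeriv_mlieBracket (hX : IsSmoothFieldNear I X p) (hY : IsSmoothFieldNear I Y p)
    (hh : IsSmoothFunNear I h p) :
    fieldDeriv I (mlieBracket I X Y) h p
      = fieldDeriv I X (fieldDeriv I Y h) p - fieldDeriv I Y (fieldDeriv I X h) p := by
  by_cases hs : ∀ v : TangentSpace I p, v = 0
  · simp [fieldDeriv, hs]
  push Not at hs
  obtain ⟨v, hv⟩ := hs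
  set Z := FiberBundle.extend E v with hZ
  have sZ : IsSmoothFieldNear I Z p := .extend v
  have two : minSmoothness ℝ 2 ≤ ∞ := by
    simpa using WithTop.coe_le_coe.2 (le_top (a := (2 : ℕ∞)))
  have : IsManifold I (minSmoothness ℝ 3) M := by simpa using (inferInstance : IsManifold I 3 M)
  have L1 := leibniz_identity_mlieBracket_apply (hX.contMDiffAt.of_le two) (hY.contMDiffAt.of_le two)
    (sZ.contMDiffAt.of_le two)
  have L2 := leibniz_identity_mlieBracket_apply (hX.contMDiffAt.of_le two) (hY.contMDiffAt.of_le two)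
    ((sZ.smul hh).contMDiffAt.of_le two)
  have e : ∀ {U : (p : M) → TangentSpace I p}, mlieBracket I U (h • Z) =ᶠ[𝓝 p]
      fieldDeriv I U h • Z + h • mlieBracket I U Z := by
    intro U
    filter_upwards [hh.eventually, sZ.eventually] with x h₁ h₂
    exact mlieBracket_smul_right' h₁.mdifferentiableAt h₂.mdifferentiableAt
  have e' : ∀ {U V : (p : M) → TangentSpace I p}, IsSmoothFieldNear I U p →
      mlieBracket I V (mlieBracket I U (h • Z)) p
        = fieldDeriv I V (fieldDeriv I U h) p • Z p + fieldDeriv I U h p • mlieBracket I V Z p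
          + (fieldDeriv I V h p • mlieBracket I U Z p
            + h p • mlieBracket I V (mlieBracket I U Z) p) := by
    intro U V hU
    rw [EventuallyEq.rfl.mlieBracket_vectorField_eq e, mlieBracket_add_right,
      mlieBracket_smul_right' (hU.fieldDeriv hh).mdifferentiableAt sZ.mdifferentiableAt,
      mlieBracket_smul_right' hh.mdifferentiableAt (hU.mlieBracket sZ).mdifferentiableAt]
    · exact (sZ.smul (hU.fieldDeriv hh)).mdifferentiableAt
    · exact ((hU.mlieBracket sZ).smul hh).mdifferentiableAt
  rw [e' hY, e' hX, mlieBracket_smul_right' hh.mdifferentiableAt sZ.mdifferentiableAt, L1] at L2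
  have L3 : (fieldDeriv I (mlieBracket I X Y) h p - (fieldDeriv I X (fieldDeriv I Y h) p
      - fieldDeriv I Y (fieldDeriv I X h) p)) • Z p = 0 := by
    rw [← sub_eq_zero] at L2
    rw [← neg_eq_zero, ← L2]
    module
  rcases smul_eq_zero.1 L3 with h0 | h0
  · linarith
  · simp [hZ, hv] at h0

end Smoothness

end Fields

section LeviCivita

open Filter Topology VectorField

set_option linter.unusedSectionVars false

variable {E : Type*} [NormedAddCommGroup E] [NormedSpace ℝ E] [FiniteDimensional ℝ E]
  [CompleteSpace E] {H : Type*} [TopologicalSpace H] {I : ModelWithCorners ℝ E H}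
  {M : Type*} [TopologicalSpace M] [ChartedSpace H M] [IsManifold I ∞ M]
  [RiemannianBundle (fun p : M => TangentSpace I p)]
  [IsContMDiffRiemannianBundle I ∞ E (fun p : M => TangentSpace I p)]
  {X X' Y Y' Z Z' : (p : M) → TangentSpace I p} {g h : M → ℝ} {p : M}

lemma mdifferentiableAt_inner (hX : MDiffAt (T% X) p) (hY : MDiffAt (T% Y) p) :
    MDiffAt (fun q => inner ℝ (X q) (Y q)) p :=
  have : IsContMDiffRiemannianBundle I 1 E (fun p : M => TangentSpace I p) :=
    .of_le (n := ∞) (by simp)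
  MDifferentiableAt.inner_bundle (E := fun p : M => TangentSpace I p) hX hY

lemma fieldDeriv_mul_inner (hh : MDiffAt h p) (hY : MDiffAt (T% Y) p) (hZ : MDiffAt (T% Z) p) :
    fieldDeriv I X (fun q => h q * inner ℝ (Y q) (Z q)) p
      = fieldDeriv I X h p * inner ℝ (Y p) (Z p)
        + h p * fieldDeriv I X (fun q => inner ℝ (Y q) (Z q)) p :=
  fieldDeriv_mul hh (mdifferentiableAt_inner hY hZ)

lemma fieldDeriv_inner_add_inner (hY : MDiffAt (T% Y) p) (hY' : MDiffAt (T% Y') p)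
    (hZ : MDiffAt (T% Z) p) (hZ' : MDiffAt (T% Z') p) :
    fieldDeriv I X (fun q => inner ℝ (Y q) (Z q) + inner ℝ (Y' q) (Z' q)) p
      = fieldDeriv I X (fun q => inner ℝ (Y q) (Z q)) p
        + fieldDeriv I X (fun q => inner ℝ (Y' q) (Z' q)) p :=
  fieldDeriv_add (mdifferentiableAt_inner hY hZ) (mdifferentiableAt_inner hY' hZ')

lemma koszul_congr (e : X =ᶠ[𝓝 p] X') (e' : Y =ᶠ[𝓝 p] Y') :
    koszul I X Y Z p = koszul I X' Y' Z p := by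
  simp only [koszul]
  rw [e.mlieBracket_vectorField_eq e', e.mlieBracket_vectorField_eq (EventuallyEq.refl _ Z),
    e'.mlieBracket_vectorField_eq (EventuallyEq.refl _ Z),
    fieldDeriv_congr_field (h := fun q => inner ℝ (Y q) (Z q)) e.self_of_nhds,
    fieldDeriv_congr_field (h := fun q => inner ℝ (X q) (Z q)) e'.self_of_nhds,
    fieldDeriv_congr (g := fun q => inner ℝ (Y q) (Z q)) (h := fun q => inner ℝ (Y' q) (Z q))
      (by filter_upwards [e'] with x hx; rw [hx]),
    fieldDeriv_congr (g := fun q => inner ℝ (X q) (Z q)) (h := fun q => inner ℝ (X' q) (Z q))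
      (by filter_upwards [e] with x hx; rw [hx]),
    fieldDeriv_congr (g := fun q => inner ℝ (X q) (Y q)) (h := fun q => inner ℝ (X' q) (Y' q))
      (by filter_upwards [e, e'] with x hx hx'; rw [hx, hx']), e.self_of_nhds, e'.self_of_nhds]

lemma koszul_tensorialAt_right (hX : MDiffAt (T% X) p) (hY : MDiffAt (T% Y) p) :
    TensorialAt I E (fun Z => koszul I X Y Z p) p where
  smul {h Z} hh hZ := by
    simp only [koszul, fieldDeriv_mul_inner hh hY hZ, fieldDeriv_mul_inner hh hX hZ,
      fieldDeriv_smul_field, mlieBracket_smul_right' hh hZ, Pi.smul_apply', inner_smul_right,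
      inner_add_left, real_inner_smul_left, smul_eq_mul]
    rw [real_inner_comm (Y p) (Z p), real_inner_comm (X p) (Z p)]
    ring
  add {Z Z'} hZ hZ' := by
    simp only [koszul, fieldDeriv_inner_add_inner hY hY hZ hZ', fieldDeriv_inner_add_inner hX hX hZ hZ',
      fieldDeriv_add_field, mlieBracket_add_right hZ hZ', Pi.add_apply, inner_add_right,
      inner_add_left]
    ring

lemma koszul_tensorialAt_left (hY : MDiffAt (T% Y) p) (hZ : MDiffAt (T% Z) p) :
    TensorialAt I E (fun X => koszul I X Y Z p) p where
  smul {h X} hh hX := by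
    simp only [koszul, fieldDeriv_mul_inner hh hX hY, fieldDeriv_mul_inner hh hX hZ,
      fieldDeriv_smul_field, mlieBracket_smul_left' hh hX, Pi.smul_apply', inner_smul_right,
      inner_add_left, real_inner_smul_left, smul_eq_mul, inner_neg_left]
    ring
  add {X X'} hX hX' := by
    simp only [koszul, fieldDeriv_inner_add_inner hX hX' hY hY, fieldDeriv_inner_add_inner hX hX' hZ hZ,
      fieldDeriv_add_field, mlieBracket_add_left hX hX', Pi.add_apply, inner_add_right,
      inner_add_left]
    ring

lemma koszul_smul_middle (hh : MDiffAt h p) (hX : MDiffAt (T% X) p) (hY : MDiffAt (T% Y) p)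
    (hZ : MDiffAt (T% Z) p) :
    koszul I X (h • Y) Z p
      = fieldDeriv I X h p * inner ℝ (Y p) (Z p) + h p * koszul I X Y Z p := by
  simp only [koszul, fieldDeriv_mul_inner hh hY hZ, fieldDeriv_mul_inner hh hX hY,
    fieldDeriv_smul_field, mlieBracket_smul_left' hh hY, mlieBracket_smul_right' hh hY,
    Pi.smul_apply', inner_smul_right, inner_add_left, real_inner_smul_left, inner_neg_left]
  rw [real_inner_comm (X p) (Y p)]
  ring

lemma koszul_add_middle (hX : MDiffAt (T% X) p) (hY : MDiffAt (T% Y) p) (hY' : MDiffAt (T% Y') p)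
    (hZ : MDiffAt (T% Z) p) :
    koszul I X (Y + Y') Z p = koszul I X Y Z p + koszul I X Y' Z p := by
  simp only [koszul, fieldDeriv_inner_add_inner hY hY' hZ hZ, fieldDeriv_inner_add_inner hX hX hY hY',
    fieldDeriv_add_field, mlieBracket_add_left hY hY', mlieBracket_add_right hY hY',
    Pi.add_apply, inner_add_right, inner_add_left]
  ring

lemma leviCivita_congr (e : X =ᶠ[𝓝 p] X') (e' : Y =ᶠ[𝓝 p] Y') :
    leviCivita I X Y p = leviCivita I X' Y' p := by
  simp only [leviCivita, koszul_congr e e']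

/-- The Levi-Civita connection is characterized by the Koszul formula. -/
lemma inner_leviCivita (hX : MDiffAt (T% X) p) (hY : MDiffAt (T% Y) p) (hZ : MDiffAt (T% Z) p) :
    inner ℝ (leviCivita I X Y p) (Z p) = koszul I X Y Z p := by
  have T := koszul_tensorialAt_right hX hY
  rw [leviCivita, sum_inner, ← TensorialAt.mkHom_apply T hZ]
  conv_rhs => rw [← (tangentONB I p).sum_repr (Z p), map_sum]
  refine Finset.sum_congr rfl fun i _ => ?_
  rw [map_smul, real_inner_smul_left, TensorialAt.mkHom_apply_eq_extend,
    OrthonormalBasis.repr_apply_apply, smul_eq_mul, mul_comm]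

lemma eq_of_inner_koszul {v w : TangentSpace I p}
    (h : ∀ Z : (p : M) → TangentSpace I p, MDiffAt (T% Z) p →
      inner ℝ v (Z p) = inner ℝ w (Z p)) : v = w := by
  refine ext_inner_right ℝ fun u => ?_
  have := h (FiberBundle.extend E u) (FiberBundle.mdifferentiableAt_extend I E u)
  simpa using this

lemma leviCivita_tensorialAt (hY : MDiffAt (T% Y) p) :
    TensorialAt I E (fun X => leviCivita I X Y p) p where
  smul {h X} hh hX := eq_of_inner_koszul fun Z hZ => by
    rw [inner_leviCivita (hh.smul_section hX) hY hZ, real_inner_smul_left, inner_leviCivita hX hY hZ]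
    exact (koszul_tensorialAt_left hY hZ).smul hh hX
  add {X X'} hX hX' := eq_of_inner_koszul fun Z hZ => by
    rw [inner_leviCivita (mdifferentiableAt_add_section hX hX') hY hZ, inner_add_left,
      inner_leviCivita hX hY hZ, inner_leviCivita hX' hY hZ]
    exact (koszul_tensorialAt_left hY hZ).add hX hX'

lemma leviCivita_smul_right (hh : MDiffAt h p) (hX : MDiffAt (T% X) p) (hY : MDiffAt (T% Y) p) :
    leviCivita I X (h • Y) p = fieldDeriv I X h p • Y p + h p • leviCivita I X Y p :=
  eq_of_inner_koszul fun Z hZ => by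
    rw [inner_leviCivita hX (hh.smul_section hY) hZ, koszul_smul_middle hh hX hY hZ, inner_add_left,
      real_inner_smul_left, real_inner_smul_left, inner_leviCivita hX hY hZ]

lemma leviCivita_add_right (hX : MDiffAt (T% X) p) (hY : MDiffAt (T% Y) p)
    (hY' : MDiffAt (T% Y') p) :
    leviCivita I X (Y + Y') p = leviCivita I X Y p + leviCivita I X Y' p :=
  eq_of_inner_koszul fun Z hZ => by
    rw [inner_leviCivita hX (mdifferentiableAt_add_section hY hY') hZ,
      koszul_add_middle hX hY hY' hZ, inner_add_left,
      inner_leviCivita hX hY hZ, inner_leviCivita hX hY' hZ]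

lemma leviCivita_sum_right {ι : Type*} [Fintype ι] {Y : ι → (p : M) → TangentSpace I p}
    (hX : MDiffAt (T% X) p) (hY : ∀ i, MDiffAt (T% (Y i)) p) :
    leviCivita I X (fun q => ∑ i, Y i q) p = ∑ i, leviCivita I X (Y i) p := by
  classical
  suffices ∀ s : Finset ι, MDiffAt (T% (fun q => ∑ i ∈ s, Y i q)) p ∧
      leviCivita I X (fun q => ∑ i ∈ s, Y i q) p = ∑ i ∈ s, leviCivita I X (Y i) p from
    (this Finset.univ).2
  intro s
  refine ⟨MDifferentiableAt.sum_section fun i _ => hY i, ?_⟩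
  induction s using Finset.induction_on with
  | empty =>
    simp only [Finset.sum_empty]
    have h0 : MDiffAt (T% (0 : (p : M) → TangentSpace I p)) p :=
      mdifferentiable_zeroSection ..
    have := leviCivita_add_right hX h0 h0
    rw [add_zero, left_eq_add] at this
    exact this
  | insert a s ha ih =>
    simp only [Finset.sum_insert ha]
    rw [← ih]
    exact leviCivita_add_right hX (hY a) (MDifferentiableAt.sum_section fun i _ => hY i)

lemma leviCivita_eq_sum (hX : MDiffAt (T% X) p) (hY : MDiffAt (T% Y) p)
    {ι : Type*} [Fintype ι] {e : ι → (p : M) → TangentSpace I p}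
    (he : ∀ i, MDiffAt (T% (e i)) p) {a : ι → ℝ} (hXe : X p = ∑ i, a i • e i p) :
    leviCivita I X Y p = ∑ i, a i • leviCivita I (e i) Y p := by
  have T := leviCivita_tensorialAt hY
  rw [← TensorialAt.mkHom_apply T hX, hXe, map_sum]
  simp only [map_smul, TensorialAt.mkHom_apply T (he _)]

end LeviCivita

section Frames

open Filter Topology VectorField

set_option linter.unusedSectionVars false

variable {E : Type*} [NormedAddCommGroup E] [NormedSpace ℝ E] [FiniteDimensional ℝ E]
  [CompleteSpace E] {H : Type*} [TopologicalSpace H] {I : ModelWithCorners ℝ E H}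
  {M : Type*} [TopologicalSpace M] [ChartedSpace H M] [IsManifold I ∞ M]
  [RiemannianBundle (fun p : M => TangentSpace I p)]
  {ι : Type*} [Fintype ι] {e : ι → (p : M) → TangentSpace I p}
  {X X' Y Y' Z Z' : (p : M) → TangentSpace I p} {g h : M → ℝ} {p : M}

/-- A family of vector fields that is a smooth orthonormal frame near `p`. -/
structure IsOrthonormalFrameNear (I : ModelWithCorners ℝ E H) {M : Type*} [TopologicalSpace M]
    [ChartedSpace H M] [IsManifold I ∞ M] [RiemannianBundle (fun p : M => TangentSpace I p)]
    (e : ι → (p : M) → TangentSpace I p) (p : M) : Prop where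
  smooth (i : ι) : IsSmoothFieldNear I (e i) p
  orthonormal : ∀ᶠ q in 𝓝 p, Orthonormal ℝ (fun i => e i q)
  card : Fintype.card ι = finrank ℝ E

lemma Orthonormal.sum_inner_smul_tangent {v : ι → TangentSpace I p} (hv : Orthonormal ℝ v)
    (hc : Fintype.card ι = finrank ℝ E) (w : TangentSpace I p) : ∑ i, inner ℝ (v i) w • v i = w := by
  have : FiniteDimensional ℝ (TangentSpace I p) := inferInstanceAs (FiniteDimensional ℝ E)
  have hc' : Fintype.card ι = finrank ℝ (TangentSpace I p) := hc
  let b := OrthonormalBasis.mk hv (hv.linearIndependent.span_eq_top_of_card_eq_finrank' hc').ge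
  simpa [b] using b.sum_repr' w

/-- Parseval's identity: the trace of a product of two linear forms. -/
lemma sum_tangentONB_mul {v : ι → TangentSpace I p} (hv : Orthonormal ℝ v)
    (hc : Fintype.card ι = finrank ℝ E) (A B : TangentSpace I p →ₗ[ℝ] ℝ) :
    ∑ i, A (tangentONB I p i) * B (tangentONB I p i) = ∑ j, A (v j) * B (v j) := by
  have e1 : ∀ w, A w = ∑ j, inner ℝ (v j) w * A (v j) := fun w => by
    conv_lhs => rw [← hv.sum_inner_smul_tangent hc w]
    simp
  have e2 : ∀ w, B w = ∑ j, inner ℝ (v j) w * B (v j) := fun w => by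
    conv_lhs => rw [← hv.sum_inner_smul_tangent hc w]
    simp
  have P : ∀ j k, ∑ i, inner ℝ (v j) (tangentONB I p i) * inner ℝ (v k) (tangentONB I p i)
      = inner ℝ (v j) (v k) := fun j k => by
    rw [← (tangentONB I p).sum_inner_mul_inner (v j) (v k)]
    exact Finset.sum_congr rfl fun i _ => by rw [real_inner_comm (tangentONB I p i) (v k)]
  classical
  calc _ = ∑ i, ∑ j, ∑ k, (inner ℝ (v j) (tangentONB I p i) * inner ℝ (v k) (tangentONB I p i))
        * (A (v j) * B (v k)) := by
        refine Finset.sum_congr rfl fun i _ => ?_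
        rw [e1 (tangentONB I p i), e2 (tangentONB I p i), Finset.sum_mul_sum]
        exact Finset.sum_congr rfl fun j _ => Finset.sum_congr rfl fun k _ => by ring
    _ = ∑ j, ∑ k, inner ℝ (v j) (v k) * (A (v j) * B (v k)) := by
        rw [Finset.sum_comm]
        refine Finset.sum_congr rfl fun j _ => ?_
        rw [Finset.sum_comm]
        refine Finset.sum_congr rfl fun k _ => ?_
        rw [← Finset.sum_mul, P]
    _ = _ := by
        refine Finset.sum_congr rfl fun j _ => ?_
        rw [Finset.sum_eq_single j]
        · simp [hv.1 j]
        · intro k _ hk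
          rw [hv.2 hk.symm, zero_mul]
        · simp

namespace IsOrthonormalFrameNear

lemma eventually (he : IsOrthonormalFrameNear I e p) :
    ∀ᶠ q in 𝓝 p, IsOrthonormalFrameNear I e q := by
  filter_upwards [eventually_all.2 fun i => (he.smooth i).eventually,
    he.orthonormal.eventually_nhds] with q h₁ h₂ using ⟨h₁, h₂, he.card⟩

lemma sum_inner_smul (he : IsOrthonormalFrameNear I e p) (v : TangentSpace I p) :
    ∑ i, inner ℝ (e i p) v • e i p = v :=
  he.orthonormal.self_of_nhds.sum_inner_smul_tangent he.card v

lemma eventually_eq_sum (he : IsOrthonormalFrameNear I e p) (X : (p : M) → TangentSpace I p) :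
    X =ᶠ[𝓝 p] fun q => ∑ i, inner ℝ (e i q) (X q) • e i q := by
  filter_upwards [he.eventually] with q hq using (hq.sum_inner_smul (X q)).symm

end IsOrthonormalFrameNear

variable [IsContMDiffRiemannianBundle I ∞ E (fun p : M => TangentSpace I p)]

lemma IsOrthonormalFrameNear.koszul_eq (he : IsOrthonormalFrameNear I e p) (i j k : ι) :
    koszul I (e i) (e j) (e k) p = (inner ℝ (mlieBracket I (e i) (e j) p) (e k p)
      - inner ℝ (mlieBracket I (e i) (e k) p) (e j p)
      - inner ℝ (mlieBracket I (e j) (e k) p) (e i p)) / 2 := by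
  have c : ∀ (X : (p : M) → TangentSpace I p) i j,
      fieldDeriv I X (fun q => inner ℝ (e i q) (e j q)) p = 0 := by
    classical
    intro X i j
    rw [fieldDeriv_congr (h := fun _ => if i = j then (1 : ℝ) else 0), fieldDeriv_const]
    filter_upwards [he.orthonormal] with q hq using orthonormal_iff_ite.1 hq i j
  simp only [koszul, c]
  ring

lemma IsOrthonormalFrameNear.leviCivita_eq (he : IsOrthonormalFrameNear I e p) (i j : ι) :
    leviCivita I (e i) (e j) p = ∑ k, koszul I (e i) (e j) (e k) p • e k p := by
  conv_lhs => rw [← he.sum_inner_smul (leviCivita I (e i) (e j) p)]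
  refine Finset.sum_congr rfl fun k _ => ?_
  rw [real_inner_comm, inner_leviCivita (he.smooth i).mdifferentiableAt
    (he.smooth j).mdifferentiableAt (he.smooth k).mdifferentiableAt]

lemma IsSmoothFieldNear.koszul (hX : IsSmoothFieldNear I X p) (hY : IsSmoothFieldNear I Y p)
    (hZ : IsSmoothFieldNear I Z p) : IsSmoothFunNear I (koszul I X Y Z) p := by
  have := (((((hX.fieldDeriv (hY.inner hZ)).add (hY.fieldDeriv (hX.inner hZ))).add
    (hZ.fieldDeriv (hX.inner hY)).neg).add ((hX.mlieBracket hY).inner hZ)).add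
    ((hX.mlieBracket hZ).inner hY).neg).add ((hY.mlieBracket hZ).inner hX).neg |>.mul
    (IsSmoothFunNear.const (1 / 2))
  refine this.congr (.of_forall fun q => ?_)
  simp only [_root_.koszul]
  ring

lemma IsOrthonormalFrameNear.smooth_leviCivita (he : IsOrthonormalFrameNear I e p)
    (hX : IsSmoothFieldNear I X p) (hY : IsSmoothFieldNear I Y p) :
    IsSmoothFieldNear I (leviCivita I X Y) p := by
  refine (IsSmoothFieldNear.sum fun i => (he.smooth i).smul (hX.koszul hY (he.smooth i))).congr ?_
  filter_upwards [he.eventually, hX.eventually, hY.eventually] with q h₁ h₂ h₃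
  rw [← h₁.sum_inner_smul (leviCivita I X Y q)]
  refine Finset.sum_congr rfl fun i _ => ?_
  rw [real_inner_comm, inner_leviCivita h₂.mdifferentiableAt h₃.mdifferentiableAt
    (h₁.smooth i).mdifferentiableAt]
  rfl

section Curvature

open Filter Topology VectorField

lemma leviCivita_congr_left (e : X =ᶠ[𝓝 p] X') : leviCivita I X Y p = leviCivita I X' Y p :=
  leviCivita_congr e .rfl

lemma leviCivita_congr_right (e : Y =ᶠ[𝓝 p] Y') : leviCivita I X Y p = leviCivita I X Y' p :=
  leviCivita_congr .rfl e

lemma leviCivita_neg_left (hX : MDiffAt (T% X) p) (hY : MDiffAt (T% Y) p) :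
    leviCivita I (-X) Y p = -leviCivita I X Y p := by
  have := (leviCivita_tensorialAt hY).smul (mdifferentiableAt_const (c := (-1 : ℝ))) hX
  have e : -X = (fun _ : M => (-1 : ℝ)) • X := by ext q; simp
  rw [e, this, neg_one_smul]

lemma curvatureField_swap (hX : IsSmoothFieldNear I X p) (hY : IsSmoothFieldNear I Y p)
    (hZ : IsSmoothFieldNear I Z p) :
    curvatureField I X Y Z p = -curvatureField I Y X Z p := by
  rw [curvatureField, curvatureField, mlieBracket_swap (V := X),
    leviCivita_neg_left (hY.mlieBracket hX).mdifferentiableAt hZ.mdifferentiableAt]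
  abel

lemma curvatureField_self (hX : IsSmoothFieldNear I X p) (hZ : IsSmoothFieldNear I Z p) :
    curvatureField I X X Z p = 0 := by
  have := curvatureField_swap hX hX hZ
  rwa [eq_neg_iff_add_eq_zero, ← two_smul ℝ, smul_eq_zero_iff_right two_ne_zero] at this

/-- An operation on vector fields that is additive and linear over functions, for fields and
functions that are smooth near `p`, and that depends only on the germ at `p`. -/
structure IsSmoothTensorialAt (I : ModelWithCorners ℝ E H) {M : Type*} [TopologicalSpace M]
    [ChartedSpace H M] [IsManifold I ∞ M] {A : Type*} [AddCommGroup A] [Module ℝ A]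
    (Φ : ((p : M) → TangentSpace I p) → A) (p : M) : Prop where
  congr {X X' : (p : M) → TangentSpace I p} : IsSmoothFieldNear I X' p → X =ᶠ[𝓝 p] X' → Φ X = Φ X'
  add {X X' : (p : M) → TangentSpace I p} : IsSmoothFieldNear I X p → IsSmoothFieldNear I X' p →
    Φ (X + X') = Φ X + Φ X'
  smul {h : M → ℝ} {X : (p : M) → TangentSpace I p} : IsSmoothFunNear I h p → IsSmoothFieldNear I X p →
    Φ (h • X) = h p • Φ X

lemma IsSmoothTensorialAt.eq_sum {A : Type*} [AddCommGroup A] [Module ℝ A]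
    {Φ : ((p : M) → TangentSpace I p) → A} (hΦ : IsSmoothTensorialAt I Φ p)
    (he : IsOrthonormalFrameNear I e p) (hX : IsSmoothFieldNear I X p) :
    Φ X = ∑ i, inner ℝ (e i p) (X p) • Φ (e i) := by
  classical
  have h0 : Φ 0 = 0 := by
    have s0 : IsSmoothFieldNear I (0 : (p : M) → TangentSpace I p) p := by
      simpa using hX.sub hX
    have := hΦ.add s0 s0
    rwa [add_zero, left_eq_add] at this
  have sm : ∀ i, IsSmoothFieldNear I ((fun q => inner ℝ (e i q) (X q)) • e i) p := fun i =>
    (he.smooth i).smul ((he.smooth i).inner hX)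
  have key : ∀ s : Finset ι, IsSmoothFieldNear I
      (∑ i ∈ s, (fun q => inner ℝ (e i q) (X q)) • e i) p ∧
      Φ (∑ i ∈ s, (fun q => inner ℝ (e i q) (X q)) • e i)
        = ∑ i ∈ s, inner ℝ (e i p) (X p) • Φ (e i) := by
    intro s
    induction s using Finset.induction_on with
    | empty => exact ⟨by simpa using hX.sub hX, by simpa using h0⟩
    | insert a s ha ih =>
      rw [Finset.sum_insert ha, Finset.sum_insert ha]
      exact ⟨(sm a).add ih.1,
        by rw [hΦ.add (sm a) ih.1, ih.2, hΦ.smul ((he.smooth a).inner hX) (he.smooth a)]⟩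
  rw [← (key Finset.univ).2]
  refine hΦ.congr (key Finset.univ).1 ?_
  filter_upwards [he.eventually_eq_sum X] with q hq
  rw [Finset.sum_apply]
  exact hq

variable (he : IsOrthonormalFrameNear I e p)
include he

lemma curvatureField_tensorial_right (hX : IsSmoothFieldNear I X p)
    (hY : IsSmoothFieldNear I Y p) :
    IsSmoothTensorialAt I (fun Z => curvatureField I X Y Z p) p where
  congr {Z Z'} hZ hh := by
    have k : ∀ W : (p : M) → TangentSpace I p, leviCivita I W Z =ᶠ[𝓝 p] leviCivita I W Z' :=
      fun W => by
        filter_upwards [hh.eventuallyEq_nhds] with q hq using leviCivita_congr_right hq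
    simp only [curvatureField]
    rw [leviCivita_congr_right (k Y), leviCivita_congr_right (k X), leviCivita_congr_right hh]
  add {Z Z'} hZ hZ' := by
    have k : ∀ {W : (p : M) → TangentSpace I p}, IsSmoothFieldNear I W p →
        leviCivita I W (Z + Z') =ᶠ[𝓝 p] leviCivita I W Z + leviCivita I W Z' := fun hW => by
      filter_upwards [hW.eventually, hZ.eventually, hZ'.eventually] with q h₁ h₂ h₃
      exact leviCivita_add_right h₁.mdifferentiableAt h₂.mdifferentiableAt h₃.mdifferentiableAt
    simp only [curvatureField]
    rw [leviCivita_congr_right (k hY), leviCivita_congr_right (k hX),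
      leviCivita_add_right hX.mdifferentiableAt (he.smooth_leviCivita hY hZ).mdifferentiableAt
        (he.smooth_leviCivita hY hZ').mdifferentiableAt,
      leviCivita_add_right hY.mdifferentiableAt (he.smooth_leviCivita hX hZ).mdifferentiableAt
        (he.smooth_leviCivita hX hZ').mdifferentiableAt,
      leviCivita_add_right (hX.mlieBracket hY).mdifferentiableAt hZ.mdifferentiableAt
        hZ'.mdifferentiableAt]
    abel
  smul {h Z} hh hZ := by
    have k : ∀ {W : (p : M) → TangentSpace I p}, IsSmoothFieldNear I W p →
        leviCivita I W (h • Z) =ᶠ[𝓝 p] fieldDeriv I W h • Z + h • leviCivita I W Z := fun hW => by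
      filter_upwards [hW.eventually, hZ.eventually, hh.eventually] with q h₁ h₂ h₃
      exact leviCivita_smul_right h₃.mdifferentiableAt h₁.mdifferentiableAt h₂.mdifferentiableAt
    have k2 : ∀ {W V : (p : M) → TangentSpace I p}, IsSmoothFieldNear I W p →
        IsSmoothFieldNear I V p →
        leviCivita I V (leviCivita I W (h • Z)) p
          = fieldDeriv I V (fieldDeriv I W h) p • Z p + fieldDeriv I W h p • leviCivita I V Z p
            + (fieldDeriv I V h p • leviCivita I W Z p
              + h p • leviCivita I V (leviCivita I W Z) p) := fun hW hV => by
      rw [leviCivita_congr_right (k hW), leviCivita_add_right hV.mdifferentiableAt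
        (hZ.smul (hW.fieldDeriv hh)).mdifferentiableAt
        ((he.smooth_leviCivita hW hZ).smul hh).mdifferentiableAt,
        leviCivita_smul_right (hW.fieldDeriv hh).mdifferentiableAt hV.mdifferentiableAt
          hZ.mdifferentiableAt,
        leviCivita_smul_right hh.mdifferentiableAt hV.mdifferentiableAt
          (he.smooth_leviCivita hW hZ).mdifferentiableAt]
    simp only [curvatureField]
    rw [k2 hY hX, k2 hX hY, leviCivita_smul_right hh.mdifferentiableAt
      (hX.mlieBracket hY).mdifferentiableAt hZ.mdifferentiableAt, fieldDeriv_mlieBracket hX hY hh]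
    module

lemma curvatureField_tensorial_left (hY : IsSmoothFieldNear I Y p)
    (hZ : IsSmoothFieldNear I Z p) :
    IsSmoothTensorialAt I (fun X => curvatureField I X Y Z p) p where
  congr {X X'} hX hh := by
    have k : leviCivita I X Z =ᶠ[𝓝 p] leviCivita I X' Z := by
      filter_upwards [hh.eventuallyEq_nhds] with q hq using leviCivita_congr_left hq
    simp only [curvatureField]
    rw [leviCivita_congr_right k, leviCivita_congr_left hh,
      leviCivita_congr_left (hh.mlieBracket_vectorField (EventuallyEq.refl _ Y))]
  add {X X'} hX hX' := by
    have k : leviCivita I (X + X') Z =ᶠ[𝓝 p] leviCivita I X Z + leviCivita I X' Z := by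
      filter_upwards [hX.eventually, hX'.eventually, hZ.eventually] with q h₁ h₂ h₃
      exact (leviCivita_tensorialAt h₃.mdifferentiableAt).add h₁.mdifferentiableAt
        h₂.mdifferentiableAt
    have b : mlieBracket I (X + X') Y =ᶠ[𝓝 p] mlieBracket I X Y + mlieBracket I X' Y := by
      filter_upwards [hX.eventually, hX'.eventually] with q h₁ h₂
      exact mlieBracket_add_left h₁.mdifferentiableAt h₂.mdifferentiableAt
    simp only [curvatureField]
    rw [leviCivita_congr_right k, leviCivita_congr_left b,
      (leviCivita_tensorialAt (he.smooth_leviCivita hY hZ).mdifferentiableAt).add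
        hX.mdifferentiableAt hX'.mdifferentiableAt,
      leviCivita_add_right hY.mdifferentiableAt (he.smooth_leviCivita hX hZ).mdifferentiableAt
        (he.smooth_leviCivita hX' hZ).mdifferentiableAt,
      (leviCivita_tensorialAt hZ.mdifferentiableAt).add (hX.mlieBracket hY).mdifferentiableAt
        (hX'.mlieBracket hY).mdifferentiableAt]
    abel
  smul {h X} hh hX := by
    have k : leviCivita I (h • X) Z =ᶠ[𝓝 p] h • leviCivita I X Z := by
      filter_upwards [hX.eventually, hh.eventually, hZ.eventually] with q h₁ h₂ h₃
      exact (leviCivita_tensorialAt h₃.mdifferentiableAt).smul h₂.mdifferentiableAt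
        h₁.mdifferentiableAt
    have b : mlieBracket I (h • X) Y =ᶠ[𝓝 p]
        (fun q => -fieldDeriv I Y h q) • X + h • mlieBracket I X Y := by
      filter_upwards [hX.eventually, hh.eventually] with q h₁ h₂
      rw [mlieBracket_smul_left' h₂.mdifferentiableAt h₁.mdifferentiableAt, ← neg_smul]
      rfl
    have sYh := (hY.fieldDeriv hh).neg
    simp only [curvatureField]
    rw [leviCivita_congr_right k, leviCivita_congr_left b,
      (leviCivita_tensorialAt (he.smooth_leviCivita hY hZ).mdifferentiableAt).smul
        hh.mdifferentiableAt hX.mdifferentiableAt,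
      leviCivita_smul_right hh.mdifferentiableAt hY.mdifferentiableAt
        (he.smooth_leviCivita hX hZ).mdifferentiableAt,
      (leviCivita_tensorialAt hZ.mdifferentiableAt).add (hX.smul sYh).mdifferentiableAt
        ((hX.mlieBracket hY).smul hh).mdifferentiableAt,
      (leviCivita_tensorialAt hZ.mdifferentiableAt).smul sYh.mdifferentiableAt
        hX.mdifferentiableAt,
      (leviCivita_tensorialAt hZ.mdifferentiableAt).smul hh.mdifferentiableAt
        (hX.mlieBracket hY).mdifferentiableAt]
    module

lemma curvatureField_eq_sum (hX : IsSmoothFieldNear I X p) (hY : IsSmoothFieldNear I Y p)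
    (hZ : IsSmoothFieldNear I Z p) :
    curvatureField I X Y Z p = ∑ i, ∑ j, ∑ k,
      (inner ℝ (e i p) (X p) * inner ℝ (e j p) (Y p) * inner ℝ (e k p) (Z p))
        • curvatureField I (e i) (e j) (e k) p := by
  rw [(curvatureField_tensorial_left he hY hZ).eq_sum he hX]
  refine Finset.sum_congr rfl fun i _ => ?_
  rw [curvatureField_swap (he.smooth i) hY hZ,
    (curvatureField_tensorial_left he (he.smooth i) hZ).eq_sum he hY, ← Finset.sum_neg_distrib,
    Finset.smul_sum]
  refine Finset.sum_congr rfl fun j _ => ?_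
  rw [← smul_neg, ← curvatureField_swap (he.smooth i) (he.smooth j) hZ,
    (curvatureField_tensorial_right he (he.smooth i) (he.smooth j)).eq_sum he hZ, Finset.smul_sum,
    Finset.smul_sum]
  exact Finset.sum_congr rfl fun k _ => by module

lemma curvature_eq_sum (u v w : TangentSpace I p) :
    curvature I u v w = ∑ i, ∑ j, ∑ k,
      (inner ℝ (e i p) u * inner ℝ (e j p) v * inner ℝ (e k p) w)
        • curvatureField I (e i) (e j) (e k) p := by
  rw [curvature, curvatureField_eq_sum he (.extend u) (.extend v) (.extend w)]
  simp

end Curvature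

end Frames

section Maps

open Filter Topology VectorField

set_option linter.unusedSectionVars false

variable {E : Type*} [NormedAddCommGroup E] [NormedSpace ℝ E] [FiniteDimensional ℝ E]
  [CompleteSpace E] {H : Type*} [TopologicalSpace H] {I : ModelWithCorners ℝ E H}
  {M : Type*} [TopologicalSpace M] [ChartedSpace H M] [IsManifold I ∞ M]
  [RiemannianBundle (fun p : M => TangentSpace I p)]
  [IsContMDiffRiemannianBundle I ∞ E (fun p : M => TangentSpace I p)]
  {E' : Type*} [NormedAddCommGroup E'] [NormedSpace ℝ E'] [FiniteDimensional ℝ E']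
  [CompleteSpace E'] {H' : Type*} [TopologicalSpace H'] {J : ModelWithCorners ℝ E' H'}
  {N : Type*} [TopologicalSpace N] [ChartedSpace H' N] [IsManifold J ∞ N]
  [RiemannianBundle (fun y : N => TangentSpace J y)]
  [IsContMDiffRiemannianBundle J ∞ E' (fun y : N => TangentSpace J y)]
  {φ : M → N} {p : M} {X X' : (p : M) → TangentSpace I p} {ε ε' : (y : N) → TangentSpace J y}

lemma fieldDeriv_comp {h : N → ℝ} (hh : MDiffAt h (φ p)) (hφ : MDifferentiableAt I J φ p) :
    fieldDeriv I X (fun q => h (φ q)) p = mvfderiv J h (φ p) (mfderiv I J φ p (X p)) :=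
  mvfderiv_comp_apply p hh hφ (X p)

lemma IsSmoothFunNear.comp {h : N → ℝ} (hh : IsSmoothFunNear J h (φ p))
    (hφ : ContMDiff I J ∞ φ) : IsSmoothFunNear I (fun q => h (φ q)) p := by
  filter_upwards [hφ.continuous.continuousAt.eventually hh] with q hq
  exact ContMDiffAt.comp q hq (hφ q)

/-- The differentials of functions separate tangent vectors. -/
lemma eq_of_mvfderiv_eq {y : N} {v w : TangentSpace J y}
    (H : ∀ h : N → ℝ, IsSmoothFunNear J h y → mvfderiv J h y v = mvfderiv J h y w) : v = w := by
  have inj : Function.Injective (mfderiv J 𝓘(ℝ, E') (extChartAt J y) y) :=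
    (isInvertible_mfderiv_extChartAt (mem_extChartAt_source y)).injective
  apply inj
  refine (SeparatingDual.eq_iff_forall_dual_eq (R := ℝ) (V := E')).2 fun L => ?_
  have hd : MDifferentiableAt J 𝓘(ℝ, E') (extChartAt J y) y :=
    mdifferentiableAt_extChartAt (mem_chart_source H' y)
  have key : ∀ u, mvfderiv J (L ∘ extChartAt J y) y u
      = L (mfderiv J 𝓘(ℝ, E') (extChartAt J y) y u) := fun u => by
    have := mfderiv_comp y (L.mdifferentiableAt (x := extChartAt J y y)) hd
    rw [mvfderiv, this, ContinuousLinearMap.mfderiv_eq]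
    rfl
  have := H (L ∘ extChartAt J y) (by
    filter_upwards [(isOpen_extChartAt_source (I := J) y).mem_nhds (mem_extChartAt_source y)]
      with z hz
    refine L.contMDiff.contMDiffAt.comp z (contMDiffAt_extChartAt' ?_)
    simpa using hz)
  rwa [key, key] at this

/-- The bracket of vector fields is compatible with `φ`-relatedness. -/
lemma mfderiv_mlieBracket (hφ : ContMDiff I J ∞ φ) (hX : IsSmoothFieldNear I X p)
    (hX' : IsSmoothFieldNear I X' p) (hε : IsSmoothFieldNear J ε (φ p))
    (hε' : IsSmoothFieldNear J ε' (φ p)) (h : ∀ q, mfderiv I J φ q (X q) = ε (φ q))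
    (h' : ∀ q, mfderiv I J φ q (X' q) = ε' (φ q)) :
    mfderiv I J φ p (mlieBracket I X X' p) = mlieBracket J ε ε' (φ p) := by
  have hd : ∀ q, MDifferentiableAt I J φ q := fun q => (hφ q).mdifferentiableAt (by simp)
  refine eq_of_mvfderiv_eq fun k hk => ?_
  have r : ∀ {Y : (p : M) → TangentSpace I p} {η : (y : N) → TangentSpace J y} {k : N → ℝ},
      IsSmoothFunNear J k (φ p) → (∀ q, mfderiv I J φ q (Y q) = η (φ q)) →
      fieldDeriv I Y (fun q => k (φ q)) =ᶠ[𝓝 p] fun q => fieldDeriv J η k (φ q) :=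
    fun {Y η k} hk hY => by
      filter_upwards [hφ.continuous.continuousAt.eventually hk.eventually] with q hq
      rw [fieldDeriv_comp hq.mdifferentiableAt (hd q), hY, fieldDeriv]
  have e1 := fieldDeriv_mlieBracket hX hX' (hk.comp hφ)
  have e2 := fieldDeriv_mlieBracket hε hε' hk
  rw [fieldDeriv_comp hk.mdifferentiableAt (hd p), fieldDeriv_congr (r hk h),
    fieldDeriv_congr (r hk h'), (r (hε'.fieldDeriv hk) h).self_of_nhds,
    (r (hε.fieldDeriv hk) h').self_of_nhds] at e1
  rw [e1, ← e2, fieldDeriv]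

/-- A submersion maps neighborhoods to neighborhoods. -/
lemma map_nhds_of_surjective_mfderiv [I.Boundaryless] [J.Boundaryless] (hφ : ContMDiff I J ∞ φ)
    (hs : Function.Surjective (mfderiv I J φ p)) : map φ (𝓝 p) = 𝓝 (φ p) := by
  have hd : MDifferentiableAt I J φ p := (hφ p).mdifferentiableAt (by simp)
  have hc : ContDiffAt ℝ ∞ (writtenInExtChartAt I J p φ) (extChartAt I p p) := by
    have := (contMDiffAt_iff.1 (hφ p)).2
    rwa [I.range_eq_univ, contDiffWithinAt_univ] at this
  have hf : mfderiv I J φ p = fderiv ℝ (writtenInExtChartAt I J p φ) (extChartAt I p p) := by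
    rw [hd.mfderiv, I.range_eq_univ, fderivWithin_univ]
  have hst := hc.hasStrictFDerivAt (by simp)
  have key := hst.map_nhds_eq_of_surj (by rw [← hf]; exact LinearMap.range_eq_top.2 hs)
  have e : φ =ᶠ[𝓝 p] (extChartAt J (φ p)).symm ∘ writtenInExtChartAt I J p φ ∘ extChartAt I p := by
    filter_upwards [extChartAt_source_mem_nhds (I := I) p,
      hφ.continuous.continuousAt (extChartAt_source_mem_nhds (I := J) (φ p))] with q h₁ h₂
    simp only [writtenInExtChartAt, Function.comp_apply]
    rw [(extChartAt I p).left_inv h₁, (extChartAt J (φ p)).left_inv h₂]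
  rw [map_congr e, ← map_map, ← map_map, map_extChartAt_nhds_of_boundaryless, key]
  have : writtenInExtChartAt I J p φ (extChartAt I p p) = extChartAt J (φ p) (φ p) := by
    simp [writtenInExtChartAt]
  rw [this]
  simpa [J.range_eq_univ] using map_extChartAt_symm_nhdsWithin_range (I := J) (φ p)

/-- The Leibniz rule for the pull-back connection on combinations of fields of the form `ε ∘ φ`. -/
lemma pullbackConn_eq {ι : Type*} [Fintype ι] {ε : ι → (y : N) → TangentSpace J y}
    {v : ι → M → ℝ} {V : (p : M) → TangentSpace J (φ p)}
    (hφ : MDifferentiableAt I J φ p) (hv : ∀ k, MDiffAt (v k) p)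
    (hε : ∀ k, MDiffAt (T% (ε k)) (φ p))
    (hV : ∀ᶠ q in 𝓝 p, V q = ∑ k, v k q • ε k (φ q)) :
    pullbackConn I J φ X V p = ∑ k, (fieldDeriv I X (v k) p • ε k (φ p)
      + v k p • leviCivita J (FiberBundle.extend E' (pushAlong I J φ X p)) (ε k) (φ p)) := by
  set t := trivializationAt E' (TangentSpace J : N → Type _) (φ p)
  set s := t.localFrame (finBasis ℝ E')
  have ht : φ p ∈ t.baseSet := FiberBundle.mem_baseSet_trivializationAt' (φ p)
  set U : (y : N) → TangentSpace J y := FiberBundle.extend E' (pushAlong I J φ X p)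
  have sU : IsSmoothFieldNear J U (φ p) := .extend _
  have hUp : U (φ p) = mfderiv I J φ p (X p) := FiberBundle.extend_apply_self _ _
  let g : ι → Fin (finrank ℝ E') → N → ℝ :=
    fun k a y => t.localFrameCoeff J (finBasis ℝ E') a y (ε k y)
  have hg : ∀ k a, MDiffAt (g k a) (φ p) := fun k a =>
    mdifferentiableAt_localFrameCoeff _ ht (hε k) a
  have hs : ∀ a, MDiffAt (T% (s a)) (φ p) := fun a =>
    (contMDiffAt_localFrame_of_mem 1 t (finBasis ℝ E') a ht).mdifferentiableAt (by simp)
  have eε : ∀ k, ε k =ᶠ[𝓝 (φ p)] fun y => (∑ a, (g k a • s a) y : TangentSpace J y) := fun k =>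
    t.eventually_eq_localFrame_sum_coeff_smul _ ht
  have L : ∀ k, leviCivita J U (ε k) (φ p)
      = ∑ a, (fieldDeriv J U (g k a) (φ p) • s a (φ p) + g k a (φ p) • leviCivita J U (s a) (φ p)) :=
    fun k => by
      rw [leviCivita_congr_right (eε k), leviCivita_sum_right sU.mdifferentiableAt
        fun a => (hg k a).smul_section (hs a)]
      exact Finset.sum_congr rfl fun a _ =>
        leviCivita_smul_right (hg k a) sU.mdifferentiableAt (hs a)
  have hgφ : ∀ k a, MDiffAt (fun q => g k a (φ q)) p := fun k a => (hg k a).comp p hφ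
  have D : ∀ a, fieldDeriv I X
      (fun q => t.localFrameCoeff J (finBasis ℝ E') a (φ q) (V q)) p
      = ∑ k, (fieldDeriv I X (v k) p * g k a (φ p) + v k p * fieldDeriv J U (g k a) (φ p)) :=
    fun a => by
      rw [fieldDeriv_congr (h := fun q => ∑ k, v k q * g k a (φ q)),
        fieldDeriv_sum (h := fun k q => v k q * g k a (φ q)) fun k => (hv k).mul (hgφ k a)]
      · refine Finset.sum_congr rfl fun k _ => ?_
        rw [fieldDeriv_mul (hv k) (hgφ k a), fieldDeriv_comp (hg k a) hφ,
          fieldDeriv.eq_def J U (g k a) (φ p), hUp]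
      · filter_upwards [hV] with q hq
        rw [hq, map_sum]
        simp [g]
  have C : ∀ a, t.localFrameCoeff J (finBasis ℝ E') a (φ p) (V p) = ∑ k, v k p * g k a (φ p) :=
    fun a => by
      rw [hV.self_of_nhds, map_sum]
      simp [g]
  change ∑ a, (fieldDeriv I X (fun q => t.localFrameCoeff J (finBasis ℝ E') a (φ q) (V q)) p
    • s a (φ p) + t.localFrameCoeff J (finBasis ℝ E') a (φ p) (V p)
      • leviCivita J U (s a) (φ p)) = _
  simp only [L, D, C]
  have e0 : ∀ k, ε k (φ p) = ∑ a, g k a (φ p) • s a (φ p) := fun k => (eε k).self_of_nhds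
  conv_rhs => simp only [e0, Finset.smul_sum, ← Finset.sum_add_distrib]
  rw [Finset.sum_comm]
  refine Finset.sum_congr rfl fun a _ => ?_
  rw [Finset.sum_smul, Finset.sum_smul, ← Finset.sum_add_distrib]
  exact Finset.sum_congr rfl fun k _ => by module

end Maps

section FrameCalculus

open Filter Topology VectorField

set_option linter.unusedSectionVars false

variable {E : Type*} [NormedAddCommGroup E] [NormedSpace ℝ E] [FiniteDimensional ℝ E]
  [CompleteSpace E] {H : Type*} [TopologicalSpace H] {I : ModelWithCorners ℝ E H}
  {M : Type*} [TopologicalSpace M] [ChartedSpace H M] [IsManifold I ∞ M]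
  [RiemannianBundle (fun p : M => TangentSpace I p)]
  [IsContMDiffRiemannianBundle I ∞ E (fun p : M => TangentSpace I p)]
  {ι : Type*} [Fintype ι] {e : ι → (p : M) → TangentSpace I p}
  {X Y Z : (p : M) → TangentSpace I p} {p : M}

/-- The Levi-Civita connection is compatible with the metric. -/
lemma fieldDeriv_inner (hX : MDiffAt (T% X) p) (hY : MDiffAt (T% Y) p) (hZ : MDiffAt (T% Z) p) :
    fieldDeriv I X (fun q => inner ℝ (Y q) (Z q)) p
      = inner ℝ (leviCivita I X Y p) (Z p) + inner ℝ (Y p) (leviCivita I X Z p) := by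
  rw [real_inner_comm (leviCivita I X Z p), inner_leviCivita hX hY hZ, inner_leviCivita hX hZ hY]
  simp only [koszul, mlieBracket_swap_apply (V := Z) (W := Y), inner_neg_left]
  rw [show (fun q => inner ℝ (Z q) (Y q)) = fun q => inner ℝ (Y q) (Z q) from
    funext fun q => real_inner_comm _ _]
  ring

/-- The trace of the covariant derivative of the `1`-form with coefficients `l` in an orthonormal
frame. -/
lemma IsOrthonormalFrameNear.sum_tangentONB_div (he : IsOrthonormalFrameNear I e p)
    {l : ι → M → ℝ} (hl : ∀ j, IsSmoothFunNear I (l j) p) :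
    ∑ i, (fieldDeriv I (FiberBundle.extend E (tangentONB I p i))
          (fun q => ∑ j, inner ℝ (e j q) (FiberBundle.extend E (tangentONB I p i) q) * l j q) p
        - ∑ j, inner ℝ (e j p) (leviCivita I (FiberBundle.extend E (tangentONB I p i))
          (FiberBundle.extend E (tangentONB I p i)) p) * l j p)
      = ∑ j, (fieldDeriv I (e j) (l j) p
          + l j p * ∑ k, inner ℝ (mlieBracket I (e k) (e j) p) (e k p)) := by
  have ho := he.orthonormal.self_of_nhds
  let K : ι → ι → TangentSpace I p →ₗ[ℝ] ℝ := fun j k =>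
    (TensorialAt.mkHom _ p (koszul_tensorialAt_left (he.smooth j).mdifferentiableAt
      (he.smooth k).mdifferentiableAt)).toLinearMap
  have hK : ∀ j k {X : (p : M) → TangentSpace I p}, MDiffAt (T% X) p →
      K j k (X p) = koszul I X (e j) (e k) p := fun j k _ hX => TensorialAt.mkHom_apply _ hX
  let D : ι → TangentSpace I p →ₗ[ℝ] ℝ := fun j => (mvfderiv I (l j) p).toLinearMap
  let P : ι → TangentSpace I p →ₗ[ℝ] ℝ := fun j => (innerSL ℝ (e j p)).toLinearMap
  have key : ∀ v : TangentSpace I p, fieldDeriv I (FiberBundle.extend E v)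
          (fun q => ∑ j, inner ℝ (e j q) (FiberBundle.extend E v q) * l j q) p
        - ∑ j, inner ℝ (e j p) (leviCivita I (FiberBundle.extend E v)
          (FiberBundle.extend E v) p) * l j p
      = ∑ j, (P j v * D j v + l j p * ∑ k, K j k v * P k v) := by
    intro v
    set U := FiberBundle.extend E v
    have hU : IsSmoothFieldNear I U p := .extend v
    have hUp : U p = v := FiberBundle.extend_apply_self _ _
    have hm : ∀ j, MDiffAt (fun q => inner ℝ (e j q) (U q)) p := fun j =>
      ((he.smooth j).inner hU).mdifferentiableAt
    rw [fieldDeriv_sum (h := fun j q => inner ℝ (e j q) (U q) * l j q)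
      fun j => (hm j).mul (hl j).mdifferentiableAt, ← Finset.sum_sub_distrib]
    refine Finset.sum_congr rfl fun j _ => ?_
    have ek : inner ℝ (leviCivita I U (e j) p) (U p) = ∑ k, K j k v * P k v := by
      conv_lhs => rw [← he.sum_inner_smul (U p), inner_sum]
      refine Finset.sum_congr rfl fun k _ => ?_
      rw [real_inner_smul_right, inner_leviCivita hU.mdifferentiableAt
        (he.smooth j).mdifferentiableAt (he.smooth k).mdifferentiableAt, ← hUp,
        hK j k hU.mdifferentiableAt, mul_comm]
      rfl
    have eD : fieldDeriv I U (l j) p = D j v := by rw [← hUp]; rfl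
    rw [fieldDeriv_mul (hm j) (hl j).mdifferentiableAt,
      fieldDeriv_inner hU.mdifferentiableAt (he.smooth j).mdifferentiableAt hU.mdifferentiableAt,
      ek, eD, hUp]
    change _ = inner ℝ (e j p) v * _ + _
    ring
  simp only [key]
  rw [Finset.sum_comm]
  refine Finset.sum_congr rfl fun j _ => ?_
  classical
  rw [Finset.sum_add_distrib, ← Finset.mul_sum, Finset.sum_comm, sum_tangentONB_mul ho he.card]
  congr 1
  · rw [Finset.sum_eq_single j]
    · simp [P, D, fieldDeriv, ho.1 j]
    · intro k _ hk
      simp [P, ho.2 hk.symm]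
    · simp
  · congr 1
    refine Finset.sum_congr rfl fun k _ => ?_
    rw [sum_tangentONB_mul ho he.card, Finset.sum_eq_single k]
    · rw [hK j k (he.smooth k).mdifferentiableAt, he.koszul_eq,
        mlieBracket_swap_apply (V := e j) (W := e k)]
      simp [P, ho.1 k]
    · intro m _ hm
      simp [P, ho.2 hm.symm]
    · simp

lemma IsOrthonormalFrameNear.inner_sum_smul (he : IsOrthonormalFrameNear I e p) (a : ι → ℝ)
    (l : ι) : inner ℝ (∑ m, a m • e m p) (e l p) = a l := by
  simpa using he.orthonormal.self_of_nhds.inner_left_fintype a l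

lemma IsOrthonormalFrameNear.inner_leviCivita_leviCivita (he : IsOrthonormalFrameNear I e p)
    (i j k l : ι) :
    inner ℝ (leviCivita I (e i) (leviCivita I (e j) (e k)) p) (e l p)
      = fieldDeriv I (e i) (koszul I (e j) (e k) (e l)) p
        + ∑ m, koszul I (e j) (e k) (e m) p * koszul I (e i) (e m) (e l) p := by
  have E1 : leviCivita I (e j) (e k) =ᶠ[𝓝 p]
      fun q => (∑ m, (koszul I (e j) (e k) (e m) • e m) q : TangentSpace I q) := by
    filter_upwards [he.eventually] with q hq using hq.leviCivita_eq j k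
  have sK := fun m => (he.smooth j).koszul (he.smooth k) (he.smooth m)
  rw [leviCivita_congr_right E1, leviCivita_sum_right (he.smooth i).mdifferentiableAt
    fun m => ((he.smooth m).smul (sK m)).mdifferentiableAt]
  have E2 : ∀ m, leviCivita I (e i) (koszul I (e j) (e k) (e m) • e m) p = _ := fun m =>
    leviCivita_smul_right (sK m).mdifferentiableAt (he.smooth i).mdifferentiableAt
      (he.smooth m).mdifferentiableAt
  simp only [E2]
  rw [Finset.sum_add_distrib, inner_add_left, he.inner_sum_smul, sum_inner]
  congr 1
  refine Finset.sum_congr rfl fun m _ => ?_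
  rw [real_inner_smul_left, inner_leviCivita (he.smooth i).mdifferentiableAt
    (he.smooth m).mdifferentiableAt (he.smooth l).mdifferentiableAt]

/-- The components of the curvature in an orthonormal frame. -/
lemma IsOrthonormalFrameNear.inner_curvatureField (he : IsOrthonormalFrameNear I e p)
    (i j k l : ι) :
    inner ℝ (curvatureField I (e i) (e j) (e k) p) (e l p)
      = fieldDeriv I (e i) (koszul I (e j) (e k) (e l)) p
        - fieldDeriv I (e j) (koszul I (e i) (e k) (e l)) p
        + ∑ m, koszul I (e j) (e k) (e m) p * koszul I (e i) (e m) (e l) p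
        - ∑ m, koszul I (e i) (e k) (e m) p * koszul I (e j) (e m) (e l) p
        - ∑ m, inner ℝ (mlieBracket I (e i) (e j) p) (e m p) * koszul I (e m) (e k) (e l) p := by
  have hb := (he.smooth i).mlieBracket (he.smooth j)
  rw [curvatureField, inner_sub_left, inner_sub_left, he.inner_leviCivita_leviCivita,
    he.inner_leviCivita_leviCivita,
    leviCivita_eq_sum hb.mdifferentiableAt (he.smooth k).mdifferentiableAt
      (fun m => (he.smooth m).mdifferentiableAt) (he.sum_inner_smul _).symm, sum_inner]
  have : ∀ m, inner ℝ (inner ℝ (e m p) (mlieBracket I (e i) (e j) p)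
      • leviCivita I (e m) (e k) p) (e l p)
      = inner ℝ (mlieBracket I (e i) (e j) p) (e m p) * koszul I (e m) (e k) (e l) p := fun m => by
    rw [real_inner_smul_left, real_inner_comm, inner_leviCivita (he.smooth m).mdifferentiableAt
      (he.smooth k).mdifferentiableAt (he.smooth l).mdifferentiableAt]
  simp only [this]
  ring

lemma IsOrthonormalFrameNear.curvature_eq_curvatureField (he : IsOrthonormalFrameNear I e p)
    (hX : IsSmoothFieldNear I X p) (hY : IsSmoothFieldNear I Y p) (hZ : IsSmoothFieldNear I Z p) :
    curvature I (X p) (Y p) (Z p) = curvatureField I X Y Z p := by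
  rw [curvature_eq_sum he, curvatureField_eq_sum he hX hY hZ]

lemma IsOrthonormalFrameNear.inner_eq_one (he : IsOrthonormalFrameNear I e p) (i : ι) :
    inner ℝ (e i p) (e i p) = (1 : ℝ) := by
  rw [real_inner_self_eq_norm_sq, he.orthonormal.self_of_nhds.1 i, one_pow]

lemma IsOrthonormalFrameNear.inner_eq_zero (he : IsOrthonormalFrameNear I e p) {i j : ι}
    (h : i ≠ j) : inner ℝ (e i p) (e j p) = (0 : ℝ) :=
  he.orthonormal.self_of_nhds.2 h

/-- The sectional curvatures of the coordinate planes of an orthonormal frame. -/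
lemma HasConstantCurvature.inner_self {c : ℝ} (hc : HasConstantCurvature I M c)
    (he : IsOrthonormalFrameNear I e p) {i j : ι} (h : i ≠ j) :
    inner ℝ (curvatureField I (e i) (e j) (e j) p) (e i p) = c := by
  have := hc p (e i p) (e j p)
  rw [he.curvature_eq_curvatureField (he.smooth i) (he.smooth j) (he.smooth j)] at this
  rw [this, he.inner_eq_one, he.inner_eq_one, he.inner_eq_zero h]
  ring

/-- The polarization of `HasConstantCurvature.inner_self`. -/
lemma HasConstantCurvature.inner_add_inner {c : ℝ} (hc : HasConstantCurvature I M c)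
    (he : IsOrthonormalFrameNear I e p) {i j k : ι} (hij : i ≠ j) (hik : i ≠ k) (hjk : j ≠ k) :
    inner ℝ (curvatureField I (e i) (e k) (e k) p) (e j p)
      + inner ℝ (curvatureField I (e j) (e k) (e k) p) (e i p) = 0 := by
  have := hc p ((e i + e j) p) (e k p)
  rw [he.curvature_eq_curvatureField ((he.smooth i).add (he.smooth j)) (he.smooth k) (he.smooth k),
    (curvatureField_tensorial_left he (he.smooth k) (he.smooth k)).add (he.smooth i)
      (he.smooth j)] at this
  simp only [Pi.add_apply, inner_add_left, inner_add_right, he.inner_eq_one, he.inner_eq_zero hij,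
    he.inner_eq_zero hij.symm, he.inner_eq_zero hik, he.inner_eq_zero hjk,
    hc.inner_self he hik, hc.inner_self he hjk] at this
  linarith

end FrameCalculus

section AdaptedFrames

open Filter Topology VectorField

set_option linter.unusedSectionVars false

variable {E : Type*} [NormedAddCommGroup E] [NormedSpace ℝ E] [FiniteDimensional ℝ E]
  [CompleteSpace E] {H : Type*} [TopologicalSpace H] {I : ModelWithCorners ℝ E H}
  {M : Type*} [TopologicalSpace M] [ChartedSpace H M] [IsManifold I ∞ M]
  [RiemannianBundle (fun p : M => TangentSpace I p)]
  [IsContMDiffRiemannianBundle I ∞ E (fun p : M => TangentSpace I p)]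
  {E' : Type*} [NormedAddCommGroup E'] [NormedSpace ℝ E'] [FiniteDimensional ℝ E']
  [CompleteSpace E'] {H' : Type*} [TopologicalSpace H'] {J : ModelWithCorners ℝ E' H'}
  {N : Type*} [TopologicalSpace N] [ChartedSpace H' N] [IsManifold J ∞ N]
  [RiemannianBundle (fun y : N => TangentSpace J y)]
  [IsContMDiffRiemannianBundle J ∞ E' (fun y : N => TangentSpace J y)]
  {φ : M → N} {p : M} {X : (p : M) → TangentSpace I p}
  {e : Fin 3 → (p : M) → TangentSpace I p} {ε : Fin 2 → (y : N) → TangentSpace J y}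

/-- The connection coefficients `⟨∇_{eᵢ} eⱼ, eₖ⟩` of an orthonormal frame of a `3`-manifold with
`[e₀,e₁] = f₁ e₀ + f₂ e₁ - 2σ e₂`, `[e₀,e₂] = κ e₂`, `[e₁,e₂] = 0`. -/
def connectionCoeff₃ {M : Type*} (f₁ f₂ κ σ : M → ℝ) (i j k : Fin 3) (q : M) : ℝ :=
  (![![![0, -f₁ q, 0], ![f₁ q, 0, -σ q], ![0, σ q, 0]],
    ![![0, -f₂ q, σ q], ![f₂ q, 0, 0], ![-σ q, 0, 0]],
    ![![0, σ q, -κ q], ![-σ q, 0, 0], ![κ q, 0, 0]]] : Fin 3 → Fin 3 → Fin 3 → ℝ) i j k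

/-- The connection coefficients `⟨∇_{εᵢ} εⱼ, εₖ⟩` of an orthonormal frame of a surface with
`[ε₀,ε₁] = F₁ ε₀ + F₂ ε₁`. -/
def connectionCoeff₂ {N : Type*} (F₁ F₂ : N → ℝ) (i j k : Fin 2) (y : N) : ℝ :=
  (![![![0, -F₁ y], ![F₁ y, 0]], ![![0, -F₂ y], ![F₂ y, 0]]] : Fin 2 → Fin 2 → Fin 2 → ℝ) i j k

lemma koszul_eq_connectionCoeff₃ (he : IsOrthonormalFrameNear I e p) {f₁ f₂ κ σ : M → ℝ}
    (h01 : mlieBracket I (e 0) (e 1) p = f₁ p • e 0 p + f₂ p • e 1 p - (2 * σ p) • e 2 p)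
    (h02 : mlieBracket I (e 0) (e 2) p = κ p • e 2 p) (h12 : mlieBracket I (e 1) (e 2) p = 0)
    (i j k : Fin 3) : koszul I (e i) (e j) (e k) p = connectionCoeff₃ f₁ f₂ κ σ i j k p := by
  have h10 := mlieBracket_swap_apply (I := I) (V := e 1) (W := e 0) (x := p)
  have h20 := mlieBracket_swap_apply (I := I) (V := e 2) (W := e 0) (x := p)
  have h21 := mlieBracket_swap_apply (I := I) (V := e 2) (W := e 1) (x := p)
  rw [h01] at h10
  rw [h02] at h20
  rw [h12] at h21
  have n : ∀ i, inner ℝ (e i p) (e i p) = (1 : ℝ) := he.inner_eq_one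
  have z : ∀ i j, i ≠ j → inner ℝ (e i p) (e j p) = (0 : ℝ) := fun i j h => he.inner_eq_zero h
  rw [he.koszul_eq]
  fin_cases i <;> fin_cases j <;> fin_cases k <;>
    simp only [Fin.zero_eta, Fin.mk_one, Fin.reduceFinMk, h01, h02, h12, h10, h20, h21,
      mlieBracket_self, Pi.zero_apply, inner_zero_left, inner_neg_left, inner_sub_left,
      inner_add_left, real_inner_smul_left, n, z 0 1 (by decide), z 0 2 (by decide),
      z 1 0 (by decide), z 1 2 (by decide), z 2 0 (by decide), z 2 1 (by decide),
      connectionCoeff₃, Matrix.cons_val] <;> ring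

lemma koszul_eq_connectionCoeff₂ {y : N} (hε : IsOrthonormalFrameNear J ε y) (i j k : Fin 2) :
    koszul J (ε i) (ε j) (ε k) y = connectionCoeff₂
      (fun z => inner ℝ (mlieBracket J (ε 0) (ε 1) z) (ε 0 z))
      (fun z => inner ℝ (mlieBracket J (ε 0) (ε 1) z) (ε 1 z)) i j k y := by
  have h10 := mlieBracket_swap_apply (I := J) (V := ε 1) (W := ε 0) (x := y)
  rw [hε.koszul_eq]
  fin_cases i <;> fin_cases j <;> fin_cases k <;>
    simp only [Fin.zero_eta, Fin.mk_one, h10,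
      mlieBracket_self, Pi.zero_apply, inner_zero_left, inner_neg_left,
      connectionCoeff₂, Matrix.cons_val] <;> ring

/-- The curvature of a surface in an orthonormal frame. -/
lemma inner_curvatureField_surface {y : N} (hε : IsOrthonormalFrameNear J ε y) :
    inner ℝ (curvatureField J (ε 0) (ε 1) (ε 1) y) (ε 0 y)
      = fieldDeriv J (ε 0) (fun z => inner ℝ (mlieBracket J (ε 0) (ε 1) z) (ε 1 z)) y
        - fieldDeriv J (ε 1) (fun z => inner ℝ (mlieBracket J (ε 0) (ε 1) z) (ε 0 z)) y
        - inner ℝ (mlieBracket J (ε 0) (ε 1) y) (ε 0 y) ^ 2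
        - inner ℝ (mlieBracket J (ε 0) (ε 1) y) (ε 1 y) ^ 2 := by
  rw [hε.inner_curvatureField]
  have h : ∀ i j k, koszul J (ε i) (ε j) (ε k) =ᶠ[𝓝 y] connectionCoeff₂
      (fun z => inner ℝ (mlieBracket J (ε 0) (ε 1) z) (ε 0 z))
      (fun z => inner ℝ (mlieBracket J (ε 0) (ε 1) z) (ε 1 z)) i j k := fun i j k => by
    filter_upwards [hε.eventually] with z hz using koszul_eq_connectionCoeff₂ hz i j k
  rw [fieldDeriv_congr (h 1 1 0), fieldDeriv_congr (h 0 1 0)]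
  simp only [fun i j k => (h i j k).self_of_nhds, Fin.sum_univ_two]
  unfold connectionCoeff₂
  simp only [Matrix.cons_val]
  ring

lemma inner_curvatureField_surface_eq_zero {y : N} (hε : IsOrthonormalFrameNear J ε y)
    (k : Fin 2) : inner ℝ (curvatureField J (ε 0) (ε 1) (ε k) y) (ε k y) = (0 : ℝ) := by
  rw [hε.inner_curvatureField]
  have h : ∀ i j k, koszul J (ε i) (ε j) (ε k) =ᶠ[𝓝 y] connectionCoeff₂
      (fun z => inner ℝ (mlieBracket J (ε 0) (ε 1) z) (ε 0 z))
      (fun z => inner ℝ (mlieBracket J (ε 0) (ε 1) z) (ε 1 z)) i j k := fun i j k => by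
    filter_upwards [hε.eventually] with z hz using koszul_eq_connectionCoeff₂ hz i j k
  have d : ∀ i, fieldDeriv J (ε i) (koszul J (ε (1 - i)) (ε k) (ε k)) y = 0 := fun i => by
    rw [fieldDeriv_congr (h := fun _ => 0), fieldDeriv_const]
    filter_upwards [h (1 - i) k k] with z hz
    rw [hz]
    generalize 1 - i = j
    fin_cases j <;> fin_cases k <;> simp [connectionCoeff₂]
  have d0 := d 0
  have d1 := d 1
  rw [sub_zero] at d0
  rw [sub_self] at d1
  rw [d0, d1]
  simp only [fun i j k => (h i j k).self_of_nhds, Fin.sum_univ_two]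
  fin_cases k <;>
  · unfold connectionCoeff₂
    simp only [Fin.zero_eta, Fin.mk_one, Matrix.cons_val]
    ring

/-- The curvature of a surface of constant curvature in an orthonormal frame. -/
lemma HasConstantCurvature.curvatureField_surface {c : ℝ} (hc : HasConstantCurvature J N c) {y : N}
    (hε : IsOrthonormalFrameNear J ε y) :
    curvatureField J (ε 0) (ε 1) (ε 1) y = c • ε 0 y ∧
      curvatureField J (ε 0) (ε 1) (ε 0) y = -(c • ε 1 y) := by
  have s := inner_curvatureField_surface_eq_zero hε
  have k0 := hc.inner_self hε (i := 0) (j := 1) (by decide)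
  have k1 := hc.inner_self hε (i := 1) (j := 0) (by decide)
  rw [curvatureField_swap (hε.smooth 1) (hε.smooth 0) (hε.smooth 0), inner_neg_left] at k1
  constructor
  · rw [← hε.sum_inner_smul (curvatureField J (ε 0) (ε 1) (ε 1) y), Fin.sum_univ_two,
      real_inner_comm, k0, real_inner_comm, s 1]
    simp
  · rw [← hε.sum_inner_smul (curvatureField J (ε 0) (ε 1) (ε 0) y), Fin.sum_univ_two,
      real_inner_comm, s 0, real_inner_comm, neg_eq_iff_eq_neg.1 k1]
    simp

lemma HasConstantCurvature.curvature_surface {c : ℝ} (hc : HasConstantCurvature J N c) {y : N}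
    (hε : IsOrthonormalFrameNear J ε y) (b₀ b₁ v₀ v₁ : ℝ) :
    curvature J (b₀ • ε 0 y + b₁ • ε 1 y) (v₀ • ε 0 y + v₁ • ε 1 y) (b₀ • ε 0 y + b₁ • ε 1 y)
      = (c * (b₀ * v₁ - b₁ * v₀) * b₁) • ε 0 y - (c * (b₀ * v₁ - b₁ * v₀) * b₀) • ε 1 y := by
  obtain ⟨h1, h0⟩ := hc.curvatureField_surface hε
  have s := hε.smooth
  rw [curvature_eq_sum hε]
  simp only [Fin.sum_univ_two, inner_add_right, real_inner_smul_right, hε.inner_eq_one,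
    hε.inner_eq_zero (show (0 : Fin 2) ≠ 1 by decide),
    hε.inner_eq_zero (show (1 : Fin 2) ≠ 0 by decide), curvatureField_self (s 0) (s _),
    curvatureField_self (s 1) (s _), curvatureField_swap (s 1) (s 0) (s _), h0, h1]
  module

/-- An orthonormal frame `e` of a `3`-manifold and a smooth orthonormal frame `ε` near the image of
`φ`, such that `e 0` and `e 1` are `φ`-related to `ε 0` and `ε 1`, and `e 2` is vertical. -/
structure IsFramedSubmersion (I : ModelWithCorners ℝ E H) (J : ModelWithCorners ℝ E' H')
    {M : Type*} [TopologicalSpace M] [ChartedSpace H M] [IsManifold I ∞ M]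
    [RiemannianBundle (fun p : M => TangentSpace I p)]
    {N : Type*} [TopologicalSpace N] [ChartedSpace H' N] [IsManifold J ∞ N]
    [RiemannianBundle (fun y : N => TangentSpace J y)]
    (φ : M → N) (e : Fin 3 → (p : M) → TangentSpace I p) (ε : Fin 2 → (y : N) → TangentSpace J y) :
    Prop where
  contMDiff : ContMDiff I J ∞ φ
  frame (p : M) : IsOrthonormalFrameNear I e p
  frame_image (p : M) : IsOrthonormalFrameNear J ε (φ p)
  mfderiv_zero (p : M) : mfderiv I J φ p (e 0 p) = ε 0 (φ p)
  mfderiv_one (p : M) : mfderiv I J φ p (e 1 p) = ε 1 (φ p)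
  mfderiv_two (p : M) : mfderiv I J φ p (e 2 p) = 0

namespace IsFramedSubmersion

variable (h : IsFramedSubmersion I J φ e ε)
include h

lemma mfderiv_apply (v : TangentSpace I p) :
    mfderiv I J φ p v = inner ℝ (e 0 p) v • ε 0 (φ p) + inner ℝ (e 1 p) v • ε 1 (φ p) := by
  conv_lhs => rw [← (h.frame p).sum_inner_smul v, Fin.sum_univ_three]
  rw [map_add, map_add, map_smul, map_smul, map_smul, h.mfderiv_zero, h.mfderiv_one, h.mfderiv_two,
    smul_zero, add_zero]

lemma inner_mfderiv_zero (v : TangentSpace I p) :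
    inner ℝ (mfderiv I J φ p v) (ε 0 (φ p)) = inner ℝ v (e 0 p) := by
  rw [h.mfderiv_apply, inner_add_left, real_inner_smul_left, real_inner_smul_left,
    (h.frame_image p).inner_eq_one, (h.frame_image p).inner_eq_zero (by decide), real_inner_comm]
  ring

lemma inner_mfderiv_one (v : TangentSpace I p) :
    inner ℝ (mfderiv I J φ p v) (ε 1 (φ p)) = inner ℝ v (e 1 p) := by
  rw [h.mfderiv_apply, inner_add_left, real_inner_smul_left, real_inner_smul_left,
    (h.frame_image p).inner_eq_one, (h.frame_image p).inner_eq_zero (by decide),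
    real_inner_comm v (e 1 p)]
  ring

lemma mfderiv_mlieBracket_zero_one :
    mfderiv I J φ p (mlieBracket I (e 0) (e 1) p) = mlieBracket J (ε 0) (ε 1) (φ p) :=
  mfderiv_mlieBracket h.contMDiff ((h.frame p).smooth 0) ((h.frame p).smooth 1)
    ((h.frame_image p).smooth 0) ((h.frame_image p).smooth 1) h.mfderiv_zero h.mfderiv_one

/-- The bracket of a basic and a vertical field is vertical. -/
lemma mlieBracket_vertical {i : Fin 3} {η : (y : N) → TangentSpace J y}
    (hη : IsSmoothFieldNear J η (φ p)) (hi : ∀ q, mfderiv I J φ q (e i q) = η (φ q)) :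
    mlieBracket I (e i) (e 2) p = inner ℝ (mlieBracket I (e i) (e 2) p) (e 2 p) • e 2 p := by
  have h0 : mfderiv I J φ p (mlieBracket I (e i) (e 2) p) = 0 := by
    rw [mfderiv_mlieBracket (ε := η) (ε' := 0) h.contMDiff ((h.frame p).smooth i)
      ((h.frame p).smooth 2) hη (by simpa using hη.sub hη) hi h.mfderiv_two, mlieBracket_zero_right]
    rfl
  have a0 := h.inner_mfderiv_zero (mlieBracket I (e i) (e 2) p)
  have a1 := h.inner_mfderiv_one (mlieBracket I (e i) (e 2) p)
  rw [h0, inner_zero_left, real_inner_comm] at a0 a1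
  conv_lhs => rw [← (h.frame p).sum_inner_smul (mlieBracket I (e i) (e 2) p), Fin.sum_univ_three,
    ← a0, ← a1, real_inner_comm]
  simp

lemma integrabilityData_f₁_eq (p : M) :
    (integrabilityData I (e 0) (e 1) (e 2)).f₁ p
      = inner ℝ (mlieBracket J (ε 0) (ε 1) (φ p)) (ε 0 (φ p)) := by
  rw [← h.mfderiv_mlieBracket_zero_one, h.inner_mfderiv_zero]
  rfl

lemma integrabilityData_f₂_eq (p : M) :
    (integrabilityData I (e 0) (e 1) (e 2)).f₂ p
      = inner ℝ (mlieBracket J (ε 0) (ε 1) (φ p)) (ε 1 (φ p)) := by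
  rw [← h.mfderiv_mlieBracket_zero_one, h.inner_mfderiv_one]
  rfl

lemma mlieBracket_zero_one (p : M) :
    mlieBracket I (e 0) (e 1) p = (integrabilityData I (e 0) (e 1) (e 2)).f₁ p • e 0 p
      + (integrabilityData I (e 0) (e 1) (e 2)).f₂ p • e 1 p
      - (2 * (integrabilityData I (e 0) (e 1) (e 2)).σ p) • e 2 p := by
  conv_lhs => rw [← (h.frame p).sum_inner_smul (mlieBracket I (e 0) (e 1) p), Fin.sum_univ_three]
  simp only [integrabilityData, real_inner_comm (mlieBracket I (e 0) (e 1) p)]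
  module

lemma mlieBracket_zero_two (p : M) :
    mlieBracket I (e 0) (e 2) p = (integrabilityData I (e 0) (e 1) (e 2)).κ₁ p • e 2 p :=
  h.mlieBracket_vertical ((h.frame_image p).smooth 0) h.mfderiv_zero

lemma mlieBracket_one_two (p : M) :
    mlieBracket I (e 1) (e 2) p = (integrabilityData I (e 0) (e 1) (e 2)).κ₂ p • e 2 p :=
  h.mlieBracket_vertical ((h.frame_image p).smooth 1) h.mfderiv_one

end IsFramedSubmersion

end AdaptedFrames

section StructureEquations

open Filter Topology VectorField

set_option linter.unusedSectionVars false

variable {E : Type*} [NormedAddCommGroup E] [NormedSpace ℝ E] [FiniteDimensional ℝ E]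
  [CompleteSpace E] {H : Type*} [TopologicalSpace H] {I : ModelWithCorners ℝ E H}
  {M : Type*} [TopologicalSpace M] [ChartedSpace H M] [IsManifold I ∞ M]
  [RiemannianBundle (fun p : M => TangentSpace I p)]
  [IsContMDiffRiemannianBundle I ∞ E (fun p : M => TangentSpace I p)]
  {E' : Type*} [NormedAddCommGroup E'] [NormedSpace ℝ E'] [FiniteDimensional ℝ E']
  [CompleteSpace E'] {H' : Type*} [TopologicalSpace H'] {J : ModelWithCorners ℝ E' H'}
  {N : Type*} [TopologicalSpace N] [ChartedSpace H' N] [IsManifold J ∞ N]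
  [RiemannianBundle (fun y : N => TangentSpace J y)]
  [IsContMDiffRiemannianBundle J ∞ E' (fun y : N => TangentSpace J y)]
  {φ : M → N} {p : M} {X : (p : M) → TangentSpace I p}
  {e : Fin 3 → (p : M) → TangentSpace I p} {ε : Fin 2 → (y : N) → TangentSpace J y}

namespace IsFramedSubmersion

variable (h : IsFramedSubmersion I J φ e ε)
include h

local notation "D" => integrabilityData I (e 0) (e 1) (e 2)

lemma smooth_bracketCoeff (i j k : Fin 3) (p : M) :
    IsSmoothFunNear I (fun q => inner ℝ (mlieBracket I (e i) (e j) q) (e k q)) p :=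
  (((h.frame p).smooth i).mlieBracket ((h.frame p).smooth j)).inner ((h.frame p).smooth k)

lemma smooth_f₁ (p : M) : IsSmoothFunNear I (D).f₁ p := h.smooth_bracketCoeff 0 1 0 p

lemma smooth_f₂ (p : M) : IsSmoothFunNear I (D).f₂ p := h.smooth_bracketCoeff 0 1 1 p

lemma smooth_κ₁ (p : M) : IsSmoothFunNear I (D).κ₁ p := h.smooth_bracketCoeff 0 2 2 p

lemma koszul_eq (hκ₂ : ∀ p, (D).κ₂ p = 0) (i j k : Fin 3) :
    koszul I (e i) (e j) (e k) = connectionCoeff₃ (D).f₁ (D).f₂ (D).κ₁ (D).σ i j k := by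
  funext p
  exact koszul_eq_connectionCoeff₃ (h.frame p) (h.mlieBracket_zero_one p) (h.mlieBracket_zero_two p)
    (by rw [h.mlieBracket_one_two, hκ₂, zero_smul]) i j k

/-- If total space and base have the same constant curvature, the horizontal distribution is
integrable. -/
lemma σ_eq_zero {c : ℝ} (hM : HasConstantCurvature I M c) (hN : HasConstantCurvature J N c)
    (hκ₂ : ∀ p, (D).κ₂ p = 0) (p : M) : (D).σ p = 0 := by
  have kM := hM.inner_self (h.frame p) (i := 0) (j := 1) (by decide)
  have kN := hN.inner_self (h.frame_image p) (i := 0) (j := 1) (by decide)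
  rw [inner_curvatureField_surface (h.frame_image p)] at kN
  have hd : MDifferentiableAt I J φ p := (h.contMDiff p).mdifferentiableAt (by simp)
  have sF : ∀ k, MDiffAt (fun z => inner ℝ (mlieBracket J (ε 0) (ε 1) z) (ε k z)) (φ p) :=
    fun k => ((((h.frame_image p).smooth 0).mlieBracket ((h.frame_image p).smooth 1)).inner
      ((h.frame_image p).smooth k)).mdifferentiableAt
  have d1 : fieldDeriv I (e 1) (D).f₁ p
      = fieldDeriv J (ε 1) (fun z => inner ℝ (mlieBracket J (ε 0) (ε 1) z) (ε 0 z)) (φ p) := by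
    rw [show (D).f₁ = fun q => (fun z => inner ℝ (mlieBracket J (ε 0) (ε 1) z) (ε 0 z)) (φ q) from
      funext h.integrabilityData_f₁_eq, fieldDeriv_comp (sF 0) hd, h.mfderiv_one, fieldDeriv]
  have d0 : fieldDeriv I (e 0) (D).f₂ p
      = fieldDeriv J (ε 0) (fun z => inner ℝ (mlieBracket J (ε 0) (ε 1) z) (ε 1 z)) (φ p) := by
    rw [show (D).f₂ = fun q => (fun z => inner ℝ (mlieBracket J (ε 0) (ε 1) z) (ε 1 z)) (φ q) from
      funext h.integrabilityData_f₂_eq, fieldDeriv_comp (sF 1) hd, h.mfderiv_zero, fieldDeriv]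
  rw [← d0, ← d1, ← h.integrabilityData_f₁_eq, ← h.integrabilityData_f₂_eq] at kN
  have n := (h.frame p).inner_eq_one
  have z : ∀ i j, i ≠ j → inner ℝ (e i p) (e j p) = (0 : ℝ) := fun i j => (h.frame p).inner_eq_zero
  rw [(h.frame p).inner_curvatureField, h.koszul_eq hκ₂ 1 1 0, h.koszul_eq hκ₂ 0 1 0,
    show connectionCoeff₃ (D).f₁ (D).f₂ (D).κ₁ (D).σ 1 1 0 = (D).f₂ from rfl,
    show connectionCoeff₃ (D).f₁ (D).f₂ (D).κ₁ (D).σ 0 1 0 = (D).f₁ from rfl] at kM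
  simp only [h.koszul_eq hκ₂, Fin.sum_univ_three, h.mlieBracket_zero_one, inner_sub_left,
    inner_add_left, real_inner_smul_left, n, z 0 1 (by decide), z 0 2 (by decide),
    z 1 0 (by decide), z 1 2 (by decide), z 2 0 (by decide), z 2 1 (by decide), connectionCoeff₃,
    Matrix.cons_val] at kM
  have : 3 * (D).σ p ^ 2 = 0 := by linarith
  simpa using this

/-- The structure equations of a Riemannian submersion between spaces of equal constant
curvature. -/
lemma structure_equations {c : ℝ} (hM : HasConstantCurvature I M c)
    (hN : HasConstantCurvature J N c) (hκ₂ : ∀ p, (D).κ₂ p = 0) (p : M) :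
    fieldDeriv I (e 0) (D).κ₁ p = c + (D).κ₁ p ^ 2 ∧ fieldDeriv I (e 1) (D).κ₁ p = 0 ∧
      (D).κ₁ p * (D).f₁ p = 0 ∧ (D).κ₁ p * (D).f₂ p = -c := by
  have hσ : (D).σ = fun _ => 0 := funext (h.σ_eq_zero hM hN hκ₂)
  have hf := h.frame p
  have k02 := hM.inner_self hf (i := 0) (j := 2) (by decide)
  have k12 := hM.inner_self hf (i := 1) (j := 2) (by decide)
  have k01 := hM.inner_add_inner hf (i := 0) (j := 1) (k := 2) (by decide) (by decide) (by decide)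
  have n := hf.inner_eq_one
  have z : ∀ i j, i ≠ j → inner ℝ (e i p) (e j p) = (0 : ℝ) := fun i j => hf.inner_eq_zero
  have z20 := z 2 0 (by decide)
  have z21 := z 2 1 (by decide)
  have g : ∀ i j, connectionCoeff₃ (D).f₁ (D).f₂ (D).κ₁ (fun _ => 0) i 2 j
      = if i = 2 ∧ j = 0 then (D).κ₁ else fun _ => 0 := fun i j => by
    fin_cases i <;> fin_cases j <;> funext q <;> simp [connectionCoeff₃]
  have e01 : mlieBracket I (e 0) (e 1) = (D).f₁ • e 0 + (D).f₂ • e 1 := by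
    funext q
    rw [h.mlieBracket_zero_one, hσ]
    simp
  have e02 : mlieBracket I (e 0) (e 2) = (D).κ₁ • e 2 := funext h.mlieBracket_zero_two
  have e12 : mlieBracket I (e 1) (e 2) = 0 := by
    funext q
    rw [h.mlieBracket_one_two, hκ₂, zero_smul]
    rfl
  rw [hf.inner_curvatureField] at k02 k12
  rw [hf.inner_curvatureField, hf.inner_curvatureField] at k01
  simp only [h.koszul_eq hκ₂, hσ, Fin.sum_univ_three, e02, e12, g, Pi.smul_apply', Pi.zero_apply,
    inner_zero_left, real_inner_smul_left, n, z20, z21] at k02 k12 k01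
  simp [connectionCoeff₃, fieldDeriv_const] at k02 k12 k01
  have two : minSmoothness ℝ 2 ≤ ∞ := by
    simpa using WithTop.coe_le_coe.2 (le_top (a := (2 : ℕ∞)))
  have : IsManifold I (minSmoothness ℝ 3) M := by simpa using (inferInstance : IsManifold I 3 M)
  have jac := leibniz_identity_mlieBracket_apply ((hf.smooth 0).contMDiffAt.of_le two)
    ((hf.smooth 1).contMDiffAt.of_le two) ((hf.smooth 2).contMDiffAt.of_le two)
  have s := fun i => (hf.smooth i).mdifferentiableAt
  rw [e12, e01, e02, mlieBracket_zero_right,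
    mlieBracket_add_left ((hf.smooth 0).smul (h.smooth_f₁ p)).mdifferentiableAt
      ((hf.smooth 1).smul (h.smooth_f₂ p)).mdifferentiableAt,
    mlieBracket_smul_left' (h.smooth_f₁ p).mdifferentiableAt (s 0),
    mlieBracket_smul_left' (h.smooth_f₂ p).mdifferentiableAt (s 1),
    mlieBracket_smul_right' (h.smooth_κ₁ p).mdifferentiableAt (s 2), e02, e12] at jac
  have j2 := congrArg (fun v => inner ℝ v (e 2 p)) jac
  simp only [Pi.zero_apply, Pi.smul_apply', inner_zero_left, inner_add_left, inner_neg_left,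
    real_inner_smul_left, n, z 0 2 (by decide), z 1 2 (by decide)] at j2
  refine ⟨by linarith, by linarith, by linarith, by linarith⟩

end IsFramedSubmersion

end StructureEquations

section Bitension

open Filter Topology VectorField

set_option linter.unusedSectionVars false

variable {E : Type*} [NormedAddCommGroup E] [NormedSpace ℝ E] [FiniteDimensional ℝ E]
  [CompleteSpace E] {H : Type*} [TopologicalSpace H] {I : ModelWithCorners ℝ E H}
  {M : Type*} [TopologicalSpace M] [ChartedSpace H M] [IsManifold I ∞ M]
  [RiemannianBundle (fun p : M => TangentSpace I p)]
  [IsContMDiffRiemannianBundle I ∞ E (fun p : M => TangentSpace I p)]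
  {E' : Type*} [NormedAddCommGroup E'] [NormedSpace ℝ E'] [FiniteDimensional ℝ E']
  [CompleteSpace E'] {H' : Type*} [TopologicalSpace H'] {J : ModelWithCorners ℝ E' H'}
  {N : Type*} [TopologicalSpace N] [ChartedSpace H' N] [IsManifold J ∞ N]
  [RiemannianBundle (fun y : N => TangentSpace J y)]
  [IsContMDiffRiemannianBundle J ∞ E' (fun y : N => TangentSpace J y)]
  {φ : M → N} {p : M} {X : (p : M) → TangentSpace I p}
  {e : Fin 3 → (p : M) → TangentSpace I p} {ε : Fin 2 → (y : N) → TangentSpace J y}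

namespace IsFramedSubmersion

variable (h : IsFramedSubmersion I J φ e ε)
include h

local notation "D" => integrabilityData I (e 0) (e 1) (e 2)

lemma pullbackConn_eq {V : (p : M) → TangentSpace J (φ p)} {v₀ v₁ : M → ℝ}
    (h₀ : MDiffAt v₀ p) (h₁ : MDiffAt v₁ p)
    (hV : ∀ q, V q = v₀ q • ε 0 (φ q) + v₁ q • ε 1 (φ q)) (X : (p : M) → TangentSpace I p) :
    pullbackConn I J φ X V p
      = (fieldDeriv I X v₀ p
          + v₁ p * (inner ℝ (e 0 p) (X p) * (D).f₁ p + inner ℝ (e 1 p) (X p) * (D).f₂ p))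
            • ε 0 (φ p)
        + (fieldDeriv I X v₁ p
          - v₀ p * (inner ℝ (e 0 p) (X p) * (D).f₁ p + inner ℝ (e 1 p) (X p) * (D).f₂ p))
            • ε 1 (φ p) := by
  have hε := h.frame_image p
  have s := fun k => (hε.smooth k).mdifferentiableAt
  rw [_root_.pullbackConn_eq (v := ![v₀, v₁]) (ε := ε) ((h.contMDiff p).mdifferentiableAt (by simp))
    (by intro k; fin_cases k; exacts [h₀, h₁]) s (.of_forall fun q => by simp [hV, Fin.sum_univ_two])]
  have key : ∀ k, leviCivita J (FiberBundle.extend E' (pushAlong I J φ X p)) (ε k) (φ p)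
      = ∑ j, (![inner ℝ (e 0 p) (X p), inner ℝ (e 1 p) (X p)] : Fin 2 → ℝ) j
        • leviCivita J (ε j) (ε k) (φ p) := fun k =>
    leviCivita_eq_sum (IsSmoothFieldNear.extend _).mdifferentiableAt (s k) s (by
      rw [FiberBundle.extend_apply_self, pushAlong, h.mfderiv_apply]
      simp [Fin.sum_univ_two])
  simp only [key, hε.leviCivita_eq, koszul_eq_connectionCoeff₂ hε, Fin.sum_univ_two,
    connectionCoeff₂, Matrix.cons_val, ← h.integrabilityData_f₁_eq, ← h.integrabilityData_f₂_eq]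
  module

/-- The trace of the covariant derivative of the horizontal `1`-form with coefficients `a`, `b`. -/
lemma sum_tangentONB_div (hκ₂ : ∀ p, (D).κ₂ p = 0) {a b : M → ℝ} (ha : IsSmoothFunNear I a p)
    (hb : IsSmoothFunNear I b p) :
    ∑ i, (fieldDeriv I (FiberBundle.extend E (tangentONB I p i))
          (fun q => inner ℝ (e 0 q) (FiberBundle.extend E (tangentONB I p i) q) * a q
            + inner ℝ (e 1 q) (FiberBundle.extend E (tangentONB I p i) q) * b q) p
        - (inner ℝ (e 0 p) (leviCivita I (FiberBundle.extend E (tangentONB I p i))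
            (FiberBundle.extend E (tangentONB I p i)) p) * a p
          + inner ℝ (e 1 p) (leviCivita I (FiberBundle.extend E (tangentONB I p i))
            (FiberBundle.extend E (tangentONB I p i)) p) * b p))
      = fieldDeriv I (e 0) a p + fieldDeriv I (e 1) b p - a p * ((D).f₂ p + (D).κ₁ p)
        + b p * (D).f₁ p := by
  have hf := h.frame p
  have n := hf.inner_eq_one
  have z : ∀ i j, i ≠ j → inner ℝ (e i p) (e j p) = (0 : ℝ) := fun i j => hf.inner_eq_zero
  have := hf.sum_tangentONB_div (l := ![a, b, fun _ => 0])
    (by intro j; fin_cases j; exacts [ha, hb, .const 0])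
  simp only [Fin.sum_univ_three, Matrix.cons_val, mul_zero, add_zero, fieldDeriv_const,
    mlieBracket_self, Pi.zero_apply, inner_zero_left, zero_add,
    mlieBracket_swap_apply (V := e 1) (W := e 0), mlieBracket_swap_apply (V := e 2) (W := e 0),
    mlieBracket_swap_apply (V := e 2) (W := e 1), h.mlieBracket_zero_one, h.mlieBracket_zero_two,
    h.mlieBracket_one_two, hκ₂, zero_smul, inner_neg_left, inner_sub_left, inner_add_left,
    real_inner_smul_left, n, z 0 1 (by decide), z 1 0 (by decide), z 2 0 (by decide),
    z 2 1 (by decide)] at this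
  rw [this]
  ring

lemma sum_tangentONB_mul (A B : TangentSpace I p →ₗ[ℝ] ℝ) :
    ∑ i, A (tangentONB I p i) * B (tangentONB I p i)
      = A (e 0 p) * B (e 0 p) + A (e 1 p) * B (e 1 p) + A (e 2 p) * B (e 2 p) := by
  rw [_root_.sum_tangentONB_mul (h.frame p).orthonormal.self_of_nhds (h.frame p).card,
    Fin.sum_univ_three]

lemma sum_tangentONB_inner_mul (A : TangentSpace I p →ₗ[ℝ] ℝ) (j : Fin 3) :
    ∑ i, inner ℝ (e j p) (tangentONB I p i) * A (tangentONB I p i) = A (e j p) := by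
  have hf := h.frame p
  have := h.sum_tangentONB_mul (innerSL ℝ (e j p)).toLinearMap A
  simp only [ContinuousLinearMap.coe_coe, innerSL_apply_apply] at this
  rw [this]
  fin_cases j <;> simp [hf.orthonormal.self_of_nhds.1, hf.inner_eq_zero]

/-- The tension field of a Riemannian submersion. -/
lemma tension_eq (hκ₂ : ∀ p, (D).κ₂ p = 0) (p : M) :
    tension I J φ p = -((D).κ₁ p • ε 0 (φ p)) := by
  have hf := h.frame p
  have n := hf.inner_eq_one
  have z : ∀ i j, i ≠ j → inner ℝ (e i p) (e j p) = (0 : ℝ) := fun i j => hf.inner_eq_zero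
  have key : ∀ i, pullbackConn I J φ (FiberBundle.extend E (tangentONB I p i))
          (pushAlong I J φ (FiberBundle.extend E (tangentONB I p i))) p
        - pushAlong I J φ (leviCivita I (FiberBundle.extend E (tangentONB I p i))
          (FiberBundle.extend E (tangentONB I p i))) p = _ := fun i => by
    have hU : IsSmoothFieldNear I (FiberBundle.extend E (tangentONB I p i)) p := .extend _
    rw [h.pullbackConn_eq (V := pushAlong I J φ (FiberBundle.extend E (tangentONB I p i)))
      ((hf.smooth 0).inner hU).mdifferentiableAt
      ((hf.smooth 1).inner hU).mdifferentiableAt fun q => h.mfderiv_apply _, pushAlong,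
      h.mfderiv_apply, FiberBundle.extend_apply_self]
  have d0 := h.sum_tangentONB_div (p := p) hκ₂ (.const 1) (.const 0)
  have d1 := h.sum_tangentONB_div (p := p) hκ₂ (.const 0) (.const 1)
  let w : TangentSpace I p →ₗ[ℝ] ℝ :=
    (D).f₁ p • (innerSL ℝ (e 0 p)).toLinearMap + (D).f₂ p • (innerSL ℝ (e 1 p)).toLinearMap
  have hw : ∀ v, inner ℝ (e 0 p) v * (D).f₁ p + inner ℝ (e 1 p) v * (D).f₂ p = w v := fun v => by
    simp [w, mul_comm]
  have w0 := h.sum_tangentONB_inner_mul w 0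
  have w1 := h.sum_tangentONB_inner_mul w 1
  rw [← hw, n, z 1 0 (by decide)] at w0
  rw [← hw, n, z 0 1 (by decide)] at w1
  simp only [mul_one, mul_zero, add_zero, zero_add, fieldDeriv_const] at d0 d1
  have split : ∀ a b a' b' : ℝ, a • ε 0 (φ p) + b • ε 1 (φ p) - (a' • ε 0 (φ p) + b' • ε 1 (φ p))
      = (a - a') • ε 0 (φ p) + (b - b') • ε 1 (φ p) := fun a b a' b' => by module
  simp only [tension, key, hw, split]
  rw [Finset.sum_add_distrib, ← Finset.sum_smul, ← Finset.sum_smul]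
  simp only [add_sub_right_comm _ (_ * _), sub_right_comm _ (_ * _), Finset.sum_add_distrib,
    Finset.sum_sub_distrib, w0, w1] at d0 d1 ⊢
  rw [d0, d1]
  module

/-- The Jacobi operator on multiples of a basic horizontal field. -/
lemma neg_jacobiOperator_eq {c : ℝ} (hN : HasConstantCurvature J N c) (hκ₂ : ∀ p, (D).κ₂ p = 0)
    {V : (p : M) → TangentSpace J (φ p)} {v : M → ℝ} (hv : ∀ p, IsSmoothFunNear I v p)
    (hV : ∀ q, V q = v q • ε 0 (φ q)) (p : M) :
    -jacobiOperator I J φ V p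
      = (laplacian I v p - v p * ((D).f₁ p ^ 2 + (D).f₂ p ^ 2) + c * v p) • ε 0 (φ p)
        - (2 * ((D).f₁ p * fieldDeriv I (e 0) v p + (D).f₂ p * fieldDeriv I (e 1) v p)
          + v p * (fieldDeriv I (e 0) (D).f₁ p + fieldDeriv I (e 1) (D).f₂ p
            - (D).κ₁ p * (D).f₁ p)) • ε 1 (φ p) := by
  have hf := h.frame p
  have n := hf.inner_eq_one
  have z : ∀ i j, i ≠ j → inner ℝ (e i p) (e j p) = (0 : ℝ) := fun i j => hf.inner_eq_zero
  have hC : ∀ (X : (p : M) → TangentSpace I p) (q : M), pullbackConn I J φ X V q = _ := fun X q =>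
    h.pullbackConn_eq (v₁ := fun _ => 0) (X := X) (hv q).mdifferentiableAt
      (IsSmoothFunNear.const 0).mdifferentiableAt (by simpa using hV)
  let w : TangentSpace I p →ₗ[ℝ] ℝ :=
    (D).f₁ p • (innerSL ℝ (e 0 p)).toLinearMap + (D).f₂ p • (innerSL ℝ (e 1 p)).toLinearMap
  have hw : ∀ v, inner ℝ (e 0 p) v * (D).f₁ p + inner ℝ (e 1 p) v * (D).f₂ p = w v := fun v => by
    simp [w, mul_comm]
  have w_zero : w (e 0 p) = (D).f₁ p := by rw [← hw, n, z 1 0 (by decide)]; ring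
  have w_one : w (e 1 p) = (D).f₂ p := by rw [← hw, n, z 0 1 (by decide)]; ring
  have w_two : w (e 2 p) = 0 := by rw [← hw, z 0 2 (by decide), z 1 2 (by decide)]; ring
  have wv := h.sum_tangentONB_mul w (mvfderiv I v p).toLinearMap
  have ww := h.sum_tangentONB_mul w w
  have x1 := h.sum_tangentONB_inner_mul (innerSL ℝ (e 1 p)).toLinearMap 1
  have x0 := h.sum_tangentONB_inner_mul (innerSL ℝ (e 1 p)).toLinearMap 0
  have dw := h.sum_tangentONB_div hκ₂ (h.smooth_f₁ p) (h.smooth_f₂ p)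
  have key : ∀ i, pullbackConn I J φ (FiberBundle.extend E (tangentONB I p i))
          (pullbackConn I J φ (FiberBundle.extend E (tangentONB I p i)) V) p
        - pullbackConn I J φ (leviCivita I (FiberBundle.extend E (tangentONB I p i))
          (FiberBundle.extend E (tangentONB I p i))) V p
      = ((fieldDeriv I (FiberBundle.extend E (tangentONB I p i))
          (fieldDeriv I (FiberBundle.extend E (tangentONB I p i)) v) p
        - fieldDeriv I (leviCivita I (FiberBundle.extend E (tangentONB I p i))
          (FiberBundle.extend E (tangentONB I p i))) v p)
          - v p * (w (tangentONB I p i) * w (tangentONB I p i))) • ε 0 (φ p)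
        - (2 * (w (tangentONB I p i) * mvfderiv I v p (tangentONB I p i))
          + v p * (fieldDeriv I (FiberBundle.extend E (tangentONB I p i))
          (fun q => inner ℝ (e 0 q) (FiberBundle.extend E (tangentONB I p i) q) * (D).f₁ q
            + inner ℝ (e 1 q) (FiberBundle.extend E (tangentONB I p i) q) * (D).f₂ q) p
        - (inner ℝ (e 0 p) (leviCivita I (FiberBundle.extend E (tangentONB I p i))
            (FiberBundle.extend E (tangentONB I p i)) p) * (D).f₁ p
          + inner ℝ (e 1 p) (leviCivita I (FiberBundle.extend E (tangentONB I p i))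
            (FiberBundle.extend E (tangentONB I p i)) p) * (D).f₂ p))) • ε 1 (φ p) := by
    intro i
    set U := FiberBundle.extend E (tangentONB I p i)
    have hU : IsSmoothFieldNear I U p := .extend _
    have hUp : U p = tangentONB I p i := FiberBundle.extend_apply_self _ _
    have s_form : IsSmoothFunNear I
        (fun q => inner ℝ (e 0 q) (U q) * (D).f₁ q + inner ℝ (e 1 q) (U q) * (D).f₂ q) p :=
      (((hf.smooth 0).inner hU).mul (h.smooth_f₁ p)).add
        (((hf.smooth 1).inner hU).mul (h.smooth_f₂ p))
    rw [hC, h.pullbackConn_eq (V := pullbackConn I J φ U V)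
      (v₀ := fieldDeriv I U v) (v₁ := fun q => -(v q * (inner ℝ (e 0 q) (U q) * (D).f₁ q
        + inner ℝ (e 1 q) (U q) * (D).f₂ q)))
      (hU.fieldDeriv (hv p)).mdifferentiableAt ((hv p).mul s_form).neg.mdifferentiableAt
      (fun q => by rw [hC, fieldDeriv_const]; module),
      fieldDeriv_neg, fieldDeriv_mul (hv p).mdifferentiableAt s_form.mdifferentiableAt,
      fieldDeriv_const, show fieldDeriv I U v p = mvfderiv I v p (tangentONB I p i) by
        rw [← hUp]; rfl, hUp, hw]
    module
  have curv : ∀ i, curvature J (mfderiv I J φ p (tangentONB I p i)) (V p)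
      (mfderiv I J φ p (tangentONB I p i))
      = (-(c * v p) * (inner ℝ (e 1 p) (tangentONB I p i)
          * inner ℝ (e 1 p) (tangentONB I p i))) • ε 0 (φ p)
        + ((c * v p) * (inner ℝ (e 0 p) (tangentONB I p i)
          * inner ℝ (e 1 p) (tangentONB I p i))) • ε 1 (φ p) := fun i => by
    have := hN.curvature_surface (h.frame_image p) (inner ℝ (e 0 p) (tangentONB I p i))
      (inner ℝ (e 1 p) (tangentONB I p i)) (v p) 0
    rw [zero_smul, add_zero] at this
    rw [h.mfderiv_apply, hV, this]
    module
  simp only [ContinuousLinearMap.coe_coe, innerSL_apply_apply, n, z 1 0 (by decide), w_zero, w_one,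
    w_two] at wv ww x1 x0
  rw [jacobiOperator, neg_neg, roughLaplacian]
  simp only [key, curv]
  rw [Finset.sum_sub_distrib, Finset.sum_add_distrib, ← Finset.sum_smul, ← Finset.sum_smul,
    ← Finset.sum_smul, ← Finset.sum_smul, Finset.sum_sub_distrib, Finset.sum_add_distrib,
    ← Finset.mul_sum, ← Finset.mul_sum, ← Finset.mul_sum, ← Finset.mul_sum, ← Finset.mul_sum,
    wv, ww, x1, x0, dw, ← laplacian]
  simp only [fieldDeriv]
  module

end IsFramedSubmersion

end Bitension

section EqualCurvature

open Filter Topology VectorField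

set_option linter.unusedSectionVars false

variable {E : Type*} [NormedAddCommGroup E] [NormedSpace ℝ E] [FiniteDimensional ℝ E]
  [CompleteSpace E] {H : Type*} [TopologicalSpace H] {I : ModelWithCorners ℝ E H}
  {M : Type*} [TopologicalSpace M] [ChartedSpace H M] [IsManifold I ∞ M]
  [RiemannianBundle (fun p : M => TangentSpace I p)]
  [IsContMDiffRiemannianBundle I ∞ E (fun p : M => TangentSpace I p)]
  {E' : Type*} [NormedAddCommGroup E'] [NormedSpace ℝ E'] [FiniteDimensional ℝ E']
  [CompleteSpace E'] {H' : Type*} [TopologicalSpace H'] {J : ModelWithCorners ℝ E' H'}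
  {N : Type*} [TopologicalSpace N] [ChartedSpace H' N] [IsManifold J ∞ N]
  [RiemannianBundle (fun y : N => TangentSpace J y)]
  [IsContMDiffRiemannianBundle J ∞ E' (fun y : N => TangentSpace J y)]
  {φ : M → N} {p : M} {X : (p : M) → TangentSpace I p}
  {e : Fin 3 → (p : M) → TangentSpace I p} {ε : Fin 2 → (y : N) → TangentSpace J y}

lemma laplacian_neg (u : M → ℝ) (p : M) :
    laplacian I (fun q => -u q) p = -laplacian I u p := by
  have : ∀ X : (p : M) → TangentSpace I p,
      fieldDeriv I X (fun q => -u q) = fun q => -fieldDeriv I X u q :=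
    fun X => funext fun q => fieldDeriv_neg
  simp only [laplacian, this, fieldDeriv_neg, ← Finset.sum_neg_distrib]
  exact Finset.sum_congr rfl fun _ _ => by ring

namespace IsFramedSubmersion

variable (h : IsFramedSubmersion I J φ e ε)
include h

local notation "D" => integrabilityData I (e 0) (e 1) (e 2)

/-- The `f`-bitension field of a Riemannian submersion between spaces of equal constant
curvature. -/
lemma fBitension_eq {c : ℝ} (hM : HasConstantCurvature I M c) (hN : HasConstantCurvature J N c)
    (hκ₂ : ∀ p, (D).κ₂ p = 0) {f : M → ℝ} (hf : ∀ p, IsSmoothFunNear I f p) (p : M) :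
    fBitension I J f φ p
      = (-laplacian I (fun q => f q * (D).κ₁ q) p
          + f p * (D).κ₁ p * (-c + c ^ 2 / (D).κ₁ p ^ 2)) • ε 0 (φ p)
        - (2 * (c * fieldDeriv I (e 1) f p)) • ε 1 (φ p) := by
  have hu : ∀ p, IsSmoothFunNear I (fun q => f q * (D).κ₁ q) p :=
    fun p => (hf p).mul (h.smooth_κ₁ p)
  obtain ⟨s0, s1, s2, s3⟩ := h.structure_equations hM hN hκ₂ p
  have mf := (hf p).mdifferentiableAt
  have mκ := (h.smooth_κ₁ p).mdifferentiableAt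
  have a0 : (D).κ₁ p * fieldDeriv I (e 0) (D).f₁ p = -((c + (D).κ₁ p ^ 2) * (D).f₁ p) := by
    have := fieldDeriv_mul (X := e 0) mκ (h.smooth_f₁ p).mdifferentiableAt
    rw [funext fun q => (h.structure_equations hM hN hκ₂ q).2.2.1, fieldDeriv_const, s0] at this
    linarith
  have a1 : (D).κ₁ p * fieldDeriv I (e 1) (D).f₂ p = 0 := by
    have := fieldDeriv_mul (X := e 1) mκ (h.smooth_f₂ p).mdifferentiableAt
    rw [funext fun q => (h.structure_equations hM hN hκ₂ q).2.2.2, fieldDeriv_const, s1] at this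
    linarith
  have cf : c * (D).f₁ p = 0 := by linear_combination -(D).f₂ p * s2 + (D).f₁ p * s3
  rw [fBitension, h.neg_jacobiOperator_eq hN hκ₂ (v := fun q => -(f q * (D).κ₁ q))
    (fun p => (hu p).neg) (fun q => by rw [h.tension_eq hκ₂]; module),
    laplacian_neg,
    fieldDeriv_neg, fieldDeriv_neg, fieldDeriv_mul mf mκ, fieldDeriv_mul mf mκ, s0, s1]
  congr 2
  · have : (D).κ₁ p * ((D).f₁ p ^ 2 + (D).f₂ p ^ 2) = (D).κ₁ p * (c ^ 2 / (D).κ₁ p ^ 2) := by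
      rcases eq_or_ne ((D).κ₁ p) 0 with hk | hk
      · rw [hk, zero_mul, zero_mul]
      · have f1 : (D).f₁ p = 0 := (mul_eq_zero.1 s2).resolve_left hk
        rw [f1]
        field_simp
        linear_combination ((D).κ₁ p * (D).f₂ p - c) * s3
    linear_combination f p * this
  · linear_combination -f p * cf - 2 * fieldDeriv I (e 0) f p * s2
      - 2 * fieldDeriv I (e 1) f p * s3 - f p * a0 - f p * a1

end IsFramedSubmersion

/-- An adapted frame of a Riemannian submersion from a `3`-manifold to a surface, together with the
related frame of the surface. -/
lemma IsAdaptedFrame.exists_isFramedSubmersion [I.Boundaryless] [J.Boundaryless]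
    (dE : finrank ℝ E = 3) (dE' : finrank ℝ E' = 2) (hφ : IsRiemannianSubmersion I J φ)
    {e₁ e₂ e₃ : (p : M) → TangentSpace I p} (he : IsAdaptedFrame I J φ e₁ e₂ e₃) :
    ∃ ε : Fin 2 → (y : N) → TangentSpace J y, IsFramedSubmersion I J φ ![e₁, e₂, e₃] ε := by
  obtain ⟨ε₁, hε₁, h₁⟩ := he.basic₁
  obtain ⟨ε₂, hε₂, h₂⟩ := he.basic₂
  have frame : ∀ p, IsOrthonormalFrameNear I ![e₁, e₂, e₃] p := fun p =>
    { smooth := by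
        intro i
        fin_cases i
        exacts [.of_contMDiff he.contMDiff₁, .of_contMDiff he.contMDiff₂,
          .of_contMDiff he.contMDiff₃]
      orthonormal := .of_forall fun q => by
        convert he.orthonormal q using 2 with i
        fin_cases i <;> rfl
      card := by simp [dE] }
  have vert : ∀ p (w : TangentSpace I p), mfderiv I J φ p w = 0 →
      inner ℝ (e₁ p) w = (0 : ℝ) ∧ inner ℝ (e₂ p) w = (0 : ℝ) := by
    intro p w hw
    have ap : ∀ w : TangentSpace I p, mfderiv I J φ p w
        = inner ℝ (e₁ p) w • ε₁ (φ p) + inner ℝ (e₂ p) w • ε₂ (φ p) := fun w => by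
      conv_lhs => rw [← (frame p).sum_inner_smul w, Fin.sum_univ_three]
      simp only [Matrix.cons_val, map_add, map_smul, h₁, h₂, he.vertical, smul_zero, add_zero]
    have li : LinearIndependent ℝ (![ε₁ (φ p), ε₂ (φ p)] : Fin 2 → TangentSpace J (φ p)) := by
      refine linearIndependent_of_top_le_span_of_card_eq_finrank ?_
        (by rw [Fintype.card_fin]; exact dE'.symm)
      intro y _
      obtain ⟨w, rfl⟩ := hφ.surjective p y
      rw [ap w]
      exact add_mem (Submodule.smul_mem _ _ (Submodule.subset_span ⟨0, rfl⟩))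
        (Submodule.smul_mem _ _ (Submodule.subset_span ⟨1, rfl⟩))
    rw [ap] at hw
    exact LinearIndependent.pair_iff.1 li _ _ hw
  have range : ∀ p, Set.range φ ∈ 𝓝 (φ p) := fun p => by
    rw [← map_nhds_of_surjective_mfderiv hφ.contMDiff (hφ.surjective p)]
    exact Filter.range_mem_map
  have ortho : ∀ p, Orthonormal ℝ
      (fun i => (![ε₁, ε₂] : Fin 2 → (y : N) → TangentSpace J y) i (φ p)) := by
    intro p
    have n := (frame p).inner_eq_one
    have o : inner ℝ (e₁ p) (e₂ p) = (0 : ℝ) :=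
      (frame p).inner_eq_zero (show (0 : Fin 3) ≠ 1 by decide)
    have i11 := hφ.isometric p (e₁ p) (e₁ p)
      (fun w hw => (vert p w hw).1) fun w hw => (vert p w hw).1
    have i12 := hφ.isometric p (e₁ p) (e₂ p)
      (fun w hw => (vert p w hw).1) fun w hw => (vert p w hw).2
    have i22 := hφ.isometric p (e₂ p) (e₂ p)
      (fun w hw => (vert p w hw).2) fun w hw => (vert p w hw).2
    rw [h₁, show inner ℝ (e₁ p) (e₁ p) = (1 : ℝ) from n 0] at i11
    rw [h₂, show inner ℝ (e₂ p) (e₂ p) = (1 : ℝ) from n 1] at i22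
    rw [h₁, h₂, o] at i12
    rw [orthonormal_iff_ite]
    intro i j
    fin_cases i <;> fin_cases j
    exacts [i11, i12, by simpa using (real_inner_comm _ _).trans i12, i22]
  refine ⟨![ε₁, ε₂], hφ.contMDiff, frame, fun p => ⟨?_, ?_, by simp [dE']⟩, h₁, h₂, he.vertical⟩
  · have sm : ∀ {η : (y : N) → TangentSpace J y}, ContMDiffOn J J.tangent ∞
        (fun y => (⟨y, η y⟩ : TangentBundle J N)) (Set.range φ) → IsSmoothFieldNear J η (φ p) :=
      fun hη => (eventually_mem_nhds_iff.2 (range p)).mono fun _ hy => hη.contMDiffAt hy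
    intro i
    fin_cases i
    exacts [sm hε₁, sm hε₂]
  · filter_upwards [range p] with y hy
    obtain ⟨q, rfl⟩ := hy
    exact ortho q

end EqualCurvature

theorem theorem3p1
    {M : Type*} [TopologicalSpace M] [T2Space M] [SecondCountableTopology M]
    [ChartedSpace (EuclideanSpace ℝ (Fin 3)) M] [IsManifold (𝓡 3) ∞ M]
    [RiemannianBundle (fun p : M => TangentSpace (𝓡 3) p)]
    [IsContMDiffRiemannianBundle (𝓡 3) ∞ (EuclideanSpace ℝ (Fin 3))
      (fun p : M => TangentSpace (𝓡 3) p)]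
    {N : Type*} [TopologicalSpace N] [T2Space N] [SecondCountableTopology N]
    [ChartedSpace (EuclideanSpace ℝ (Fin 2)) N] [IsManifold (𝓡 2) ∞ N]
    [RiemannianBundle (fun y : N => TangentSpace (𝓡 2) y)]
    [IsContMDiffRiemannianBundle (𝓡 2) ∞ (EuclideanSpace ℝ (Fin 2))
      (fun y : N => TangentSpace (𝓡 2) y)]
    (c : ℝ)
    (hM : HasConstantCurvature (𝓡 3) M c)
    (hN : HasConstantCurvature (𝓡 2) N c)
    (φ : M → N) (hφ : IsRiemannianSubmersion (𝓡 3) (𝓡 2) φ)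
    (e₁ e₂ e₃ : (p : M) → TangentSpace (𝓡 3) p)
    (he : IsAdaptedFrame (𝓡 3) (𝓡 2) φ e₁ e₂ e₃)
    (κ₁ : M → ℝ) (hκ₁ : κ₁ = (integrabilityData (𝓡 3) e₁ e₂ e₃).κ₁)
    (hκ₂ : ∀ p, (integrabilityData (𝓡 3) e₁ e₂ e₃).κ₂ p = 0)
    (f : M → ℝ) (hf : ContMDiff (𝓡 3) 𝓘(ℝ, ℝ) ∞ f) (hf_pos : ∀ p, 0 < f p) :
    -- `κ₁` has no zeros unless `c = 0`; for `c = 0` the term `c ^ 2 / κ₁ ^ 2` is `0`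
    (c ≠ 0 → ∀ p, κ₁ p ≠ 0) ∧
    (IsProperFBiharmonic (𝓡 3) (𝓡 2) f φ ↔
      (∀ p, -laplacian (𝓡 3) (fun q => f q * κ₁ q) p
          + f p * κ₁ p * (-c + c ^ 2 / κ₁ p ^ 2) = 0) ∧
      (∀ p, c * fieldDeriv (𝓡 3) e₂ f p = 0) ∧
      ¬ (∀ p, -laplacian (𝓡 3) κ₁ p + κ₁ p * (-c + c ^ 2 / κ₁ p ^ 2) = 0)) := by
  subst hκ₁
  obtain ⟨ε, h⟩ := he.exists_isFramedSubmersion finrank_euclideanSpace_fin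
    finrank_euclideanSpace_fin hφ
  have hS := h.structure_equations hM hN hκ₂
  have hF : ∀ {f : M → ℝ}, ContMDiff (𝓡 3) 𝓘(ℝ, ℝ) ∞ f → ∀ p, fBitension (𝓡 3) (𝓡 2) f φ p = _ :=
    fun hf => h.fBitension_eq hM hN hκ₂ fun p => .of_contMDiff hf
  have zero_iff : ∀ (p : M) (a b : ℝ), a • ε 0 (φ p) - (2 * b) • ε 1 (φ p) = 0 ↔ a = 0 ∧ b = 0 := by
    intro p a b
    have hε := h.frame_image p
    refine ⟨fun hab => ⟨?_, ?_⟩, fun ⟨ha, hb⟩ => by simp [ha, hb]⟩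
    · have := congrArg (fun v => (inner ℝ v (ε 0 (φ p)) : ℝ)) hab
      simpa only [inner_sub_left, real_inner_smul_left, hε.inner_eq_one,
        hε.inner_eq_zero (show (1 : Fin 2) ≠ 0 by decide), inner_zero_left, mul_one, mul_zero,
        sub_zero] using this
    · have := congrArg (fun v => (inner ℝ v (ε 1 (φ p)) : ℝ)) hab
      simp only [inner_sub_left, real_inner_smul_left, hε.inner_eq_one,
        hε.inner_eq_zero (show (0 : Fin 2) ≠ 1 by decide), inner_zero_left, mul_one, mul_zero] at this
      linarith
  refine ⟨fun hc p hp => hc ?_, ?_⟩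
  · have := (hS p).2.2.2
    rw [show (integrabilityData (𝓡 3) (![e₁, e₂, e₃] 0) (![e₁, e₂, e₃] 1) (![e₁, e₂, e₃] 2)).κ₁ p
      = 0 from hp] at this
    linarith
  · have hf' : IsFBiharmonic (𝓡 3) (𝓡 2) f φ ↔ _ :=
      (forall_congr' fun p => by rw [hF hf, zero_iff]).trans forall_and
    have h1 : IsBiharmonic (𝓡 3) (𝓡 2) φ ↔ ∀ p,
        -laplacian (𝓡 3) (integrabilityData (𝓡 3) e₁ e₂ e₃).κ₁ p
        + (integrabilityData (𝓡 3) e₁ e₂ e₃).κ₁ p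
          * (-c + c ^ 2 / (integrabilityData (𝓡 3) e₁ e₂ e₃).κ₁ p ^ 2) = 0 := by
      refine forall_congr' fun p => ?_
      have := hF (f := fun _ => 1) contMDiff_const p
      simp only [fBitension, one_smul, one_mul] at this
      rw [bitension, this, zero_iff, fieldDeriv_const, mul_zero, and_iff_left rfl]
      rfl
    rw [IsProperFBiharmonic, hf', h1, and_assoc]
    rfl
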